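/- **Notation.** For $\xi\in\mathbb R^d$ put $\langle\xi\rangle=(1+|\xi|^2)^{1/2}$. For a normed space $V$ (here $V=\mathbb R^d$ or $\mathbb R^{2d}$), $C_{\rm ap}(V)$ denotes the space of bounded continuous $f:V\to\mathbb C$ such that for every $\varepsilon>0$ the set of $\varepsilon$-almost periods $\{\tau:\sup_x|f(x+\tau)-f(x)|<\varepsilon\}$ is relatively dense, i.e. meets every translate $x+K$ of some compact set $K\subseteq V$. **Function spaces.** Let $s\ge 1$. For $C>0$ let $G^s_{{\rm ap},C}(\mathbb R^d)$ be the space of all $f\in C^\infty(\mathbb R^d)\cap C_{\rm ap}(\mathbb R^d)$ for which the norm $$\|f\|_{s,C}=\sup_{\alpha\in\mathbb N^d}C^{-|\alpha|}(\alpha!)^{-s}\sup_{x\in\mathbb R^d}|\partial^\alpha f(x)|$$ is finite. Let $G^s_{\rm ap}(\mathbb R^d)=\bigcup_{C>0}G^s_{{\rm ap},C}(\mathbb R^d)$ (equivalently, the smooth almost periodic $f$ with $|\partial^\alpha f(x)|\le C^{1+|\alpha|}(\alpha!)^s$ for all $x,\alpha$ and some $C>0$), equipped with the inductive limit topology, i.e.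 the finest locally convex vector space topology for which all inclusions $G^s_{{\rm ap},C}(\mathbb R^d)\subseteq G^s_{\rm ap}(\mathbb R^d)$, $C>0$, are continuous. **Amplitudes.** Let $m\in\mathbb R$, $0<\rho\le 1$, $s\ge1$ and $s\rho\ge 1$. The class $APS^{m,s}_{\rho,0}(\mathbb R^{3d})$ consists of all $a\in C^\infty(\mathbb R^{3d})$ such that $a(\cdot,\cdot,\xi)\in C_{\rm ap}(\mathbb R^{2d})$ for every $\xi\in\mathbb R^d$ and, for some constants $C,B>0$ and some positive integer $M>d/2$, $$|\partial_\xi^\alpha\partial_x^\beta\partial_y^\gamma a(x,y,\xi)|\le C^{1+|\alpha|+|\beta|+|\gamma|}(\beta!\,\gamma!)^{s\rho}\,\alpha!\,\langle\xi\rangle^{m-\rho|\alpha|}$$ for all $\alpha,\beta,\gamma\in\mathbb N^d$, $x,y\in\mathbb R^d$ and $\langle\xi\rangle\ge B|\alpha|^s$, and $$|\partial_\xi^\alpha\partial_x^\beta\partial_y^\gamma a(x,y,\xi)|\le C^{1+|\alpha|+|\beta|+|\gamma|}(\beta!\,\gamma!)^{s\rho}\,\alpha!$$ for all $\alpha,\beta,\gamma\in\mathbb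 N^d$ with $|\alpha|\le 2M$, $x,y\in\mathbb R^d$ and $\langle\xi\rangle<B|\alpha|^s$. **Proposition.** Let $m\in\mathbb R$, $0<\rho\le1$, $s\ge1$, $s\rho\ge1$ and $a\in APS^{m,s}_{\rho,0}(\mathbb R^{3d})$. For every $f\in G^s_{\rm ap}(\mathbb R^d)$, every $x\in\mathbb R^d$ and every $\chi\in C_c^\infty(\mathbb R^d)$ that equals one in a neighborhood of the origin, the limit $$a(x,D)f(x)=\lim_{\varepsilon\to0+}\iint_{\mathbb R^{2d}}\chi(\varepsilon y)\,\chi(\varepsilon\xi)\,e^{2\pi i\xi\cdot(x-y)}\,a(x,y,\xi)\,f(y)\,dy\,d\xi$$ exists and does not depend on $\chi$; the function $a(x,D)f$ belongs to $G^s_{\rm ap}(\mathbb R^d)$; and $f\mapsto a(x,D)f$ is a continuous linear map from $G^s_{\rm ap}(\mathbb R^d)$ to itself. -/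

import Mathlib

open scoped ContDiff Topology

noncomputable section

namespace GevreyAP

/-- The space `ℝ^d`. -/
abbrev Rd (d : ℕ) : Type := EuclideanSpace ℝ (Fin d)

/-- The `j`-th standard basis vector of `ℝ^d`. -/
def stdVec (d : ℕ) (j : Fin d) : Rd d := EuclideanSpace.single j 1

/-- The Japanese bracket `⟨ξ⟩ = (1 + |ξ|²)^(1/2)`. -/
def japanese {d : ℕ} (ξ : Rd d) : ℝ := Real.sqrt (1 + ‖ξ‖ ^ 2)

/-! ### Multi-indices and partial derivatives -/

/-- The order `|α| = α₁ + ⋯ + α_d` of a multi-index. -/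
def order {d : ℕ} (α : Fin d → ℕ) : ℕ := ∑ j, α j

/-- The factorial `α! = α₁! ⋯ α_d!` of a multi-index. -/
def multiFactorial {d : ℕ} (α : Fin d → ℕ) : ℕ := ∏ j, (α j).factorial

section Derivatives

variable {V : Type*} [NormedAddCommGroup V] [NormedSpace ℝ V]

/-- The derivative of `f` in the direction `v` (applied to smooth functions only). -/
def dirDeriv (v : V) (f : V → ℂ) : V → ℂ := fun x => fderiv ℝ f x v

/-- `∂_{e₁}^{α₁} ⋯ ∂_{e_d}^{α_d} f`, for a family of directions `e₁, …, e_d` and a multi-index `α`.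
For `V = ℝ^d` and the standard basis this is `∂^α f`. -/
def multiDeriv {d : ℕ} (e : Fin d → V) (α : Fin d → ℕ) (f : V → ℂ) : V → ℂ :=
  (List.finRange d).foldr (fun j g => (dirDeriv (e j))^[α j] g) f

theorem contDiff_dirDeriv {v : V} {f : V → ℂ} (hf : ContDiff ℝ ∞ f) :
    ContDiff ℝ ∞ (dirDeriv v f) := by
  have h : ContDiff ℝ ∞ (fderiv ℝ f) := hf.fderiv_right (by simp)
  exact h.clm_apply contDiff_const

theorem contDiff_iterate_dirDeriv {v : V} (n : ℕ) {f : V → ℂ} (hf : ContDiff ℝ ∞ f) :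
    ContDiff ℝ ∞ ((dirDeriv v)^[n] f) := by
  induction n with
  | zero => exact hf
  | succ n ih => rw [Function.iterate_succ_apply']; exact contDiff_dirDeriv ih

theorem contDiff_multiDeriv {d : ℕ} {e : Fin d → V} {α : Fin d → ℕ} {f : V → ℂ}
    (hf : ContDiff ℝ ∞ f) : ContDiff ℝ ∞ (multiDeriv e α f) := by
  unfold multiDeriv
  induction List.finRange d with
  | nil => exact hf
  | cons j l ih => exact contDiff_iterate_dirDeriv _ ih

theorem dirDeriv_add {v : V} {f g : V → ℂ} (hf : ContDiff ℝ ∞ f) (hg : ContDiff ℝ ∞ g) :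
    dirDeriv v (f + g) = dirDeriv v f + dirDeriv v g := by
  funext x
  have h1 := (hf.differentiable (by simp)) x
  have h2 := (hg.differentiable (by simp)) x
  simp [dirDeriv, fderiv_add h1 h2]

theorem dirDeriv_smul {v : V} (c : ℂ) {f : V → ℂ} (hf : ContDiff ℝ ∞ f) :
    dirDeriv v (c • f) = c • dirDeriv v f := by
  funext x
  have h1 := (hf.differentiable (by simp)) x
  simp [dirDeriv, fderiv_const_smul h1 c]

theorem multiDeriv_add {d : ℕ} {e : Fin d → V} {α : Fin d → ℕ} {f g : V → ℂ}
    (hf : ContDiff ℝ ∞ f) (hg : ContDiff ℝ ∞ g) :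
    multiDeriv e α (f + g) = multiDeriv e α f + multiDeriv e α g := by
  have iter : ∀ (v : V) (n : ℕ) {f g : V → ℂ}, ContDiff ℝ ∞ f → ContDiff ℝ ∞ g →
      (dirDeriv v)^[n] (f + g) = (dirDeriv v)^[n] f + (dirDeriv v)^[n] g := by
    intro v n f g hf hg
    induction n with
    | zero => rfl
    | succ n ih =>
      simp only [Function.iterate_succ_apply', ih]
      exact dirDeriv_add (contDiff_iterate_dirDeriv n hf) (contDiff_iterate_dirDeriv n hg)
  have key : ∀ l : List (Fin d),
      ContDiff ℝ ∞ (l.foldr (fun j g => (dirDeriv (e j))^[α j] g) f) ∧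
      ContDiff ℝ ∞ (l.foldr (fun j g => (dirDeriv (e j))^[α j] g) g) ∧
      l.foldr (fun j g => (dirDeriv (e j))^[α j] g) (f + g) =
        l.foldr (fun j g => (dirDeriv (e j))^[α j] g) f +
        l.foldr (fun j g => (dirDeriv (e j))^[α j] g) g := by
    intro l
    induction l with
    | nil => exact ⟨hf, hg, rfl⟩
    | cons j l ih =>
      obtain ⟨h1, h2, h3⟩ := ih
      refine ⟨contDiff_iterate_dirDeriv _ h1, contDiff_iterate_dirDeriv _ h2, ?_⟩
      simp only [List.foldr_cons, h3]
      exact iter _ _ h1 h2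
  exact (key _).2.2

theorem multiDeriv_smul {d : ℕ} {e : Fin d → V} {α : Fin d → ℕ} (c : ℂ) {f : V → ℂ}
    (hf : ContDiff ℝ ∞ f) : multiDeriv e α (c • f) = c • multiDeriv e α f := by
  have iter : ∀ (v : V) (n : ℕ) {f : V → ℂ}, ContDiff ℝ ∞ f →
      (dirDeriv v)^[n] (c • f) = c • (dirDeriv v)^[n] f := by
    intro v n f hf
    induction n with
    | zero => rfl
    | succ n ih =>
      simp only [Function.iterate_succ_apply', ih]
      exact dirDeriv_smul c (contDiff_iterate_dirDeriv n hf)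
  have key : ∀ l : List (Fin d),
      ContDiff ℝ ∞ (l.foldr (fun j g => (dirDeriv (e j))^[α j] g) f) ∧
      l.foldr (fun j g => (dirDeriv (e j))^[α j] g) (c • f) =
        c • l.foldr (fun j g => (dirDeriv (e j))^[α j] g) f := by
    intro l
    induction l with
    | nil => exact ⟨hf, rfl⟩
    | cons j l ih =>
      obtain ⟨h1, h3⟩ := ih
      refine ⟨contDiff_iterate_dirDeriv _ h1, ?_⟩
      simp only [List.foldr_cons, h3]
      exact iter _ _ h1
  exact (key _).2

end Derivatives

/-! ### Uniformly almost periodic functions (Bohr's definition) -/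

section AlmostPeriodic

variable {V : Type*} [NormedAddCommGroup V]

/-- `U` is relatively dense: some compact `K` satisfies `(x + K) ∩ U ≠ ∅` for all `x`. -/
def RelativelyDense (U : Set V) : Prop :=
  ∃ K : Set V, IsCompact K ∧ ∀ x : V, ∃ k ∈ K, x + k ∈ U

/-- The set of `ε`-almost periods of `f`: those `τ` with `sup_x |f (x + τ) - f x| < ε`. -/
def almostPeriods (f : V → ℂ) (ε : ℝ) : Set V :=
  {τ | ∃ η < ε, ∀ x, ‖f (x + τ) - f x‖ ≤ η}

/-- `f` belongs to `C_ap(V)`: it is continuous and bounded and, for every `ε > 0`, its set of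
`ε`-almost periods is relatively dense. -/
structure IsAlmostPeriodic (f : V → ℂ) : Prop where
  continuous : Continuous f
  bounded : ∃ R : ℝ, ∀ x, ‖f x‖ ≤ R
  relativelyDense : ∀ ε > 0, RelativelyDense (almostPeriods f ε)

theorem IsAlmostPeriodic.exists_translate {f : V → ℂ} (hf : IsAlmostPeriodic f) {ε : ℝ}
    (hε : 0 < ε) :
    ∃ K : Set V, IsCompact K ∧ ∀ x : V, ∃ k ∈ K, ∀ z, ‖f (z + x) - f (z + k)‖ < ε := by
  obtain ⟨K, hK, h⟩ := hf.relativelyDense ε hε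
  refine ⟨K, hK, fun x => ?_⟩
  obtain ⟨k, hk, η, hη, H⟩ := h (-x)
  refine ⟨k, hk, fun z => ?_⟩
  have := H (z + x)
  rw [show z + x + (-x + k) = z + k by abel, norm_sub_rev] at this
  linarith

theorem IsAlmostPeriodic.uniformContinuous {f : V → ℂ} (hf : IsAlmostPeriodic f) :
    UniformContinuous f := by
  rw [Metric.uniformContinuous_iff]
  intro ε hε
  obtain ⟨K, hK, h⟩ := hf.exists_translate (ε := ε / 3) (by linarith)
  have hu := hK.uniformContinuousAt_of_continuousAt f
    (fun x _ => hf.continuous.continuousAt) (Metric.dist_mem_uniformity (show 0 < ε / 3 by linarith))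
  obtain ⟨δ, hδ, hd⟩ := Metric.mem_uniformity_dist.1 hu
  refine ⟨δ, hδ, fun {a b} hab => ?_⟩
  obtain ⟨k, hk, hz⟩ := h a
  have h1 := hz 0
  have h2 := hz (b - a)
  have h3 : dist (f k) (f (k + (b - a))) < ε / 3 := by
    refine hd (a := k) (b := k + (b - a)) ?_ hk
    simpa [dist_eq_norm, norm_sub_rev] using hab
  rw [dist_eq_norm] at h3 ⊢
  rw [zero_add, zero_add] at h1
  rw [show b - a + a = b by abel, show b - a + k = k + (b - a) by abel, norm_sub_rev] at h2
  calc ‖f a - f b‖ = ‖(f a - f k) + (f k - f (k + (b - a))) + (f (k + (b - a)) - f b)‖ := by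
        congr 1; abel
    _ ≤ ‖f a - f k‖ + ‖f k - f (k + (b - a))‖ + ‖f (k + (b - a)) - f b‖ := norm_add₃_le
    _ < ε := by linarith

/-- The translates of an almost periodic function are totally bounded. -/
theorem IsAlmostPeriodic.exists_finite {f : V → ℂ} (hf : IsAlmostPeriodic f) {ε : ℝ}
    (hε : 0 < ε) :
    ∃ F : Set V, F.Finite ∧ ∀ x : V, ∃ y ∈ F, ∀ z, ‖f (z + x) - f (z + y)‖ < ε := by
  obtain ⟨K, hK, h⟩ := hf.exists_translate (ε := ε / 2) (by linarith)
  obtain ⟨δ, hδ, hu⟩ := Metric.uniformContinuous_iff.1 hf.uniformContinuous (ε / 2) (by linarith)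
  obtain ⟨F, -, hF, hc⟩ := hK.finite_cover_balls hδ
  refine ⟨F, hF, fun x => ?_⟩
  obtain ⟨k, hk, hz⟩ := h x
  obtain ⟨y, hy, hky⟩ := Set.mem_iUnion₂.1 (hc hk)
  refine ⟨y, hy, fun z => ?_⟩
  have h1 := hz z
  have h2 : dist (f (z + k)) (f (z + y)) < ε / 2 := hu (by simpa using hky)
  rw [dist_eq_norm] at h2
  calc ‖f (z + x) - f (z + y)‖ = ‖(f (z + x) - f (z + k)) + (f (z + k) - f (z + y))‖ := by
        congr 1; abel
    _ ≤ ‖f (z + x) - f (z + k)‖ + ‖f (z + k) - f (z + y)‖ := norm_add_le _ _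
    _ < ε := by linarith

theorem IsAlmostPeriodic.zero : IsAlmostPeriodic (0 : V → ℂ) where
  continuous := continuous_zero
  bounded := ⟨0, fun x => by simp⟩
  relativelyDense ε hε := ⟨{0}, isCompact_singleton, fun x => ⟨0, rfl, 0, hε, fun z => by simp⟩⟩

theorem IsAlmostPeriodic.smul {f : V → ℂ} (c : ℂ) (hf : IsAlmostPeriodic f) :
    IsAlmostPeriodic (c • f) where
  continuous := hf.continuous.const_smul c
  bounded := by
    obtain ⟨R, hR⟩ := hf.bounded
    refine ⟨‖c‖ * R, fun x => ?_⟩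
    simpa using mul_le_mul_of_nonneg_left (hR x) (norm_nonneg c)
  relativelyDense ε hε := by
    have hc : 0 < ‖c‖ + 1 := by positivity
    obtain ⟨K, hK, h⟩ := hf.relativelyDense (ε / (‖c‖ + 1)) (by positivity)
    refine ⟨K, hK, fun x => ?_⟩
    obtain ⟨k, hk, η, hη, H⟩ := h x
    have hη0 : 0 ≤ η := (norm_nonneg _).trans (H 0)
    refine ⟨k, hk, (‖c‖ + 1) * η, by rwa [mul_comm, ← lt_div_iff₀ hc], fun z => ?_⟩
    simp only [Pi.smul_apply, ← smul_sub, norm_smul]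
    have := mul_le_mul_of_nonneg_left (H z) (norm_nonneg c)
    linarith

theorem IsAlmostPeriodic.add {f g : V → ℂ} (hf : IsAlmostPeriodic f) (hg : IsAlmostPeriodic g) :
    IsAlmostPeriodic (f + g) where
  continuous := hf.continuous.add hg.continuous
  bounded := by
    obtain ⟨R, hR⟩ := hf.bounded
    obtain ⟨S, hS⟩ := hg.bounded
    exact ⟨R + S, fun x => (norm_add_le _ _).trans (add_le_add (hR x) (hS x))⟩
  relativelyDense ε hε := by
    have hε' : 0 < ε / 5 := by linarith
    obtain ⟨F, hF, hfF⟩ := hf.exists_finite hε'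
    obtain ⟨G, hG, hgG⟩ := hg.exists_finite hε'
    choose p hp hp' using hfF
    choose q hq hq' using hgG
    have hfin : (Set.range fun x => (p x, q x)).Finite :=
      (hF.prod hG).subset (by rintro _ ⟨x, rfl⟩; exact ⟨hp x, hq x⟩)
    have hr : ∀ y : Set.range fun x => (p x, q x), ∃ x, (p x, q x) = y.1 := fun y => y.2
    choose r hr using hr
    have := hfin.to_subtype
    refine ⟨Set.range r, (Set.finite_range r).isCompact, fun x => ?_⟩
    set w := r ⟨(p (-x), q (-x)), ⟨-x, rfl⟩⟩ with hw
    have hpq : (p w, q w) = (p (-x), q (-x)) := hr _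
    obtain ⟨h1, h2⟩ := Prod.mk.inj hpq
    refine ⟨w, ⟨_, rfl⟩, 4 * (ε / 5), by linarith, fun z => ?_⟩
    have a1 := hp' (-x) (z + x)
    have a2 := hp' w (z + x)
    have b1 := hq' (-x) (z + x)
    have b2 := hq' w (z + x)
    rw [add_neg_cancel_right, norm_sub_rev] at a1 b1
    rw [h1, add_assoc z x w] at a2
    rw [h2, add_assoc z x w] at b2
    simp only [Pi.add_apply]
    calc ‖f (z + (x + w)) + g (z + (x + w)) - (f z + g z)‖
        = ‖((f (z + (x + w)) - f (z + x + p (-x))) + (f (z + x + p (-x)) - f z)) +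
          ((g (z + (x + w)) - g (z + x + q (-x))) + (g (z + x + q (-x)) - g z))‖ := by
          congr 1; abel
      _ ≤ (‖f (z + (x + w)) - f (z + x + p (-x))‖ + ‖f (z + x + p (-x)) - f z‖) +
          (‖g (z + (x + w)) - g (z + x + q (-x))‖ + ‖g (z + x + q (-x)) - g z‖) :=
          (norm_add_le _ _).trans (add_le_add (norm_add_le _ _) (norm_add_le _ _))
      _ ≤ 4 * (ε / 5) := by linarith

end AlmostPeriodic

/-! ### The Banach spaces `G_{ap,C}^s(ℝ^d)` -/

/-- `C^{-|α|} (α!)^{-s} |∂^α f(x)|`. -/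
def weighted (d : ℕ) (s C : ℝ) (f : Rd d → ℂ) (p : (Fin d → ℕ) × Rd d) : ℝ :=
  (C ^ order p.1 * (multiFactorial p.1 : ℝ) ^ s)⁻¹ * ‖multiDeriv (stdVec d) p.1 f p.2‖

/-- `f ∈ G_{ap,C}^s(ℝ^d)`: `f` is smooth and almost periodic, and
`‖f‖_{s,C} = sup_α C^{-|α|} (α!)^{-s} sup_x |∂^α f(x)|` is finite. -/
structure MemStep (d : ℕ) (s C : ℝ) (f : Rd d → ℂ) : Prop where
  contDiff : ContDiff ℝ ∞ f
  almostPeriodic : IsAlmostPeriodic f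
  bddAbove : BddAbove (Set.range (weighted d s C f))

theorem multiFactorial_pos {d : ℕ} (α : Fin d → ℕ) : (0 : ℝ) < multiFactorial α := by
  unfold multiFactorial
  exact_mod_cast Finset.prod_pos fun j _ => Nat.factorial_pos _

theorem weight_pos {d : ℕ} (s : ℝ) {C : ℝ} (hC : 0 < C) (α : Fin d → ℕ) :
    0 < C ^ order α * (multiFactorial α : ℝ) ^ s :=
  mul_pos (pow_pos hC _) (Real.rpow_pos_of_pos (multiFactorial_pos α) _)

theorem weighted_nonneg {d : ℕ} {s C : ℝ} (hC : 0 < C) (f : Rd d → ℂ)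
    (p : (Fin d → ℕ) × Rd d) : 0 ≤ weighted d s C f p :=
  mul_nonneg (inv_nonneg.2 (weight_pos s hC p.1).le) (norm_nonneg _)

theorem weighted_add_le {d : ℕ} {s C : ℝ} (hC : 0 < C) {f g : Rd d → ℂ}
    (hf : ContDiff ℝ ∞ f) (hg : ContDiff ℝ ∞ g) (p : (Fin d → ℕ) × Rd d) :
    weighted d s C (f + g) p ≤ weighted d s C f p + weighted d s C g p := by
  unfold weighted
  rw [multiDeriv_add hf hg, ← mul_add]
  exact mul_le_mul_of_nonneg_left (norm_add_le _ _) (inv_nonneg.2 (weight_pos s hC p.1).le)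

theorem weighted_smul {d : ℕ} {s C : ℝ} (c : ℂ) {f : Rd d → ℂ}
    (hf : ContDiff ℝ ∞ f) (p : (Fin d → ℕ) × Rd d) :
    weighted d s C (c • f) p = ‖c‖ * weighted d s C f p := by
  unfold weighted
  rw [multiDeriv_smul c hf, Pi.smul_apply, norm_smul]
  ring

theorem MemStep.add {d : ℕ} {s C : ℝ} (hC : 0 < C) {f g : Rd d → ℂ}
    (hf : MemStep d s C f) (hg : MemStep d s C g) : MemStep d s C (f + g) where
  contDiff := hf.contDiff.add hg.contDiff
  almostPeriodic := hf.almostPeriodic.add hg.almostPeriodic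
  bddAbove := by
    obtain ⟨R, hR⟩ := hf.bddAbove
    obtain ⟨S, hS⟩ := hg.bddAbove
    refine ⟨R + S, ?_⟩
    rintro _ ⟨p, rfl⟩
    exact (weighted_add_le hC hf.contDiff hg.contDiff p).trans
      (add_le_add (hR ⟨p, rfl⟩) (hS ⟨p, rfl⟩))

theorem MemStep.smul {d : ℕ} {s C : ℝ} (c : ℂ) {f : Rd d → ℂ}
    (hf : MemStep d s C f) : MemStep d s C (c • f) where
  contDiff := hf.contDiff.const_smul c
  almostPeriodic := hf.almostPeriodic.smul c
  bddAbove := by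
    obtain ⟨R, hR⟩ := hf.bddAbove
    refine ⟨‖c‖ * R, ?_⟩
    rintro _ ⟨p, rfl⟩
    rw [weighted_smul c hf.contDiff]
    exact mul_le_mul_of_nonneg_left (hR ⟨p, rfl⟩) (norm_nonneg c)

theorem weighted_zero (d : ℕ) (s C : ℝ) (p : (Fin d → ℕ) × Rd d) : weighted d s C 0 p = 0 := by
  have := weighted_smul (s := s) (C := C) (0 : ℂ) (contDiff_zero_fun (𝕜 := ℝ) (E := Rd d)
    (F := ℂ) (n := ∞)) p
  simpa using this

theorem MemStep.zero (d : ℕ) (s C : ℝ) : MemStep d s C 0 where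
  contDiff := contDiff_zero_fun
  almostPeriodic := .zero
  bddAbove := ⟨0, by rintro _ ⟨p, rfl⟩; exact (weighted_zero d s C p).le⟩

theorem MemStep.mono {d : ℕ} {s C C' : ℝ} (hC : 0 < C) (h : C ≤ C') {f : Rd d → ℂ}
    (hf : MemStep d s C f) : MemStep d s C' f where
  contDiff := hf.contDiff
  almostPeriodic := hf.almostPeriodic
  bddAbove := by
    obtain ⟨R, hR⟩ := hf.bddAbove
    refine ⟨R, ?_⟩
    rintro _ ⟨p, rfl⟩
    refine le_trans ?_ (hR ⟨p, rfl⟩)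
    unfold weighted
    refine mul_le_mul_of_nonneg_right (inv_anti₀ (weight_pos s hC p.1) ?_) (norm_nonneg _)
    exact mul_le_mul_of_nonneg_right (pow_le_pow_left₀ hC.le h _)
      (Real.rpow_nonneg (multiFactorial_pos _).le _)

/-- `G_{ap,C}^s(ℝ^d)`, as a linear subspace of the space of all functions. -/
def stepSubmodule (d : ℕ) (s : ℝ) (C : {C : ℝ // 0 < C}) : Submodule ℂ (Rd d → ℂ) where
  carrier := {f | MemStep d s C f}
  add_mem' hf hg := hf.add C.2 hg
  zero_mem' := .zero d s C
  smul_mem' c _ hf := hf.smul c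

/-- The space `G_{ap,C}^s(ℝ^d)`. -/
def Step (d : ℕ) (s : ℝ) (C : {C : ℝ // 0 < C}) : Type := stepSubmodule d s C

instance (d : ℕ) (s : ℝ) (C : {C : ℝ // 0 < C}) : AddCommGroup (Step d s C) :=
  inferInstanceAs (AddCommGroup (stepSubmodule d s C))

instance (d : ℕ) (s : ℝ) (C : {C : ℝ // 0 < C}) : Module ℂ (Step d s C) :=
  inferInstanceAs (Module ℂ (stepSubmodule d s C))

/-- The norm `‖f‖_{s,C} = sup_{α, x} C^{-|α|} (α!)^{-s} |∂^α f(x)|`. -/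
instance (d : ℕ) (s : ℝ) (C : {C : ℝ // 0 < C}) : Norm (Step d s C) :=
  ⟨fun f => ⨆ p, weighted d s C f.1 p⟩

theorem Step.weighted_le_norm {d : ℕ} {s : ℝ} {C : {C : ℝ // 0 < C}} (f : Step d s C)
    (p : (Fin d → ℕ) × Rd d) : weighted d s C f.1 p ≤ ‖f‖ :=
  le_ciSup (MemStep.bddAbove f.2) p

theorem Step.core (d : ℕ) (s : ℝ) (C : {C : ℝ // 0 < C}) :
    NormedSpace.Core ℂ (Step d s C) where
  norm_nonneg f := Real.iSup_nonneg fun p => weighted_nonneg C.2 f.1 p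
  norm_smul c f := by
    change (⨆ p, weighted d s C (c • f.1) p) = ‖c‖ * ⨆ p, weighted d s C f.1 p
    rw [Real.mul_iSup_of_nonneg (norm_nonneg c)]
    exact iSup_congr fun p => weighted_smul c (MemStep.contDiff f.2) p
  norm_triangle f g := by
    refine ciSup_le fun p => ?_
    exact (weighted_add_le C.2 (MemStep.contDiff f.2) (MemStep.contDiff g.2) p).trans
      (add_le_add (f.weighted_le_norm p) (g.weighted_le_norm p))
  norm_eq_zero_iff f := by
    constructor
    · intro h
      apply Subtype.ext
      funext x
      have h1 := f.weighted_le_norm (0, x)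
      have h2 : multiDeriv (stdVec d) 0 f.1 x = f.1 x := by
        unfold multiDeriv
        induction List.finRange d with
        | nil => rfl
        | cons j l ih => exact ih
      rw [h] at h1
      simp only [weighted, h2] at h1
      have h3 := weight_pos s C.2 (0 : Fin d → ℕ)
      have h4 : ‖f.1 x‖ ≤ 0 := by
        by_contra! h5
        exact absurd h1 (not_le.2 (mul_pos (inv_pos.2 h3) h5))
      exact norm_le_zero_iff.1 h4
    · rintro rfl
      change (⨆ p, weighted d s C (0 : Rd d → ℂ) p) = 0
      simp [weighted_zero]

instance (d : ℕ) (s : ℝ) (C : {C : ℝ // 0 < C}) : NormedAddCommGroup (Step d s C) :=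
  NormedAddCommGroup.ofCore (Step.core d s C)

instance (d : ℕ) (s : ℝ) (C : {C : ℝ // 0 < C}) : NormedSpace ℂ (Step d s C) :=
  NormedSpace.ofCore (Step.core d s C)

/-! ### The inductive limit `G_ap^s(ℝ^d) = ⋃_{C > 0} G_{ap,C}^s(ℝ^d)` -/

/-- The union of the spaces `G_{ap,C}^s(ℝ^d)`, `C > 0`, as a linear subspace of the space of all
functions. -/
def gapSubmodule (d : ℕ) (s : ℝ) : Submodule ℂ (Rd d → ℂ) where
  carrier := {f | ∃ C : {C : ℝ // 0 < C}, f ∈ stepSubmodule d s C}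
  add_mem' := by
    rintro f g ⟨C, hf⟩ ⟨C', hg⟩
    have h : 0 < max C.1 C'.1 := lt_max_of_lt_left C.2
    exact ⟨⟨max C.1 C'.1, h⟩, MemStep.add h (MemStep.mono C.2 (le_max_left _ _) hf)
      (MemStep.mono C'.2 (le_max_right _ _) hg)⟩
  zero_mem' := ⟨⟨1, one_pos⟩, .zero d s 1⟩
  smul_mem' := by
    rintro c f ⟨C, hf⟩
    exact ⟨C, MemStep.smul c hf⟩

/-- The space `G_ap^s(ℝ^d)`. -/
def Gap (d : ℕ) (s : ℝ) : Type := gapSubmodule d s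

instance (d : ℕ) (s : ℝ) : AddCommGroup (Gap d s) :=
  inferInstanceAs (AddCommGroup (gapSubmodule d s))

instance (d : ℕ) (s : ℝ) : Module ℂ (Gap d s) :=
  inferInstanceAs (Module ℂ (gapSubmodule d s))

instance (d : ℕ) (s : ℝ) : CoeFun (Gap d s) (fun _ => Rd d → ℂ) := ⟨fun f => f.1⟩

/-- The inclusion `G_{ap,C}^s(ℝ^d) ⊆ G_ap^s(ℝ^d)`. -/
def incl (d : ℕ) (s : ℝ) (C : {C : ℝ // 0 < C}) : Step d s C →ₗ[ℂ] Gap d s where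
  toFun f := ⟨f.1, C, f.2⟩
  map_add' _ _ := rfl
  map_smul' _ _ := rfl

/-- The locally convex vector space topologies on `G_ap^s(ℝ^d)` for which all inclusions
`G_{ap,C}^s(ℝ^d) ⊆ G_ap^s(ℝ^d)`, `C > 0`, are continuous. -/
def admissibleTopologies (d : ℕ) (s : ℝ) : Set (TopologicalSpace (Gap d s)) :=
  {t | @IsTopologicalAddGroup (Gap d s) t _ ∧ @ContinuousSMul ℂ (Gap d s) _ _ t ∧
    @LocallyConvexSpace ℝ (Gap d s) _ _ _ _ t ∧
    ∀ C : {C : ℝ // 0 < C}, @Continuous (Step d s C) (Gap d s) _ t (incl d s C)}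

/-- The inductive limit topology on `G_ap^s(ℝ^d)`: the finest locally convex vector space topology
for which all inclusions of the Banach spaces `G_{ap,C}^s(ℝ^d)`, `C > 0`, are continuous. (In the
order of Mathlib finer topologies are smaller; that the infimum is itself admissible is
`inductiveLimit_mem`.) -/
instance inductiveLimit (d : ℕ) (s : ℝ) : TopologicalSpace (Gap d s) :=
  sInf (admissibleTopologies d s)

theorem inductiveLimit_mem (d : ℕ) (s : ℝ) : inductiveLimit d s ∈ admissibleTopologies d s :=
  ⟨topologicalAddGroup_sInf fun _ h => h.1, continuousSMul_sInf fun _ h => h.2.1,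
    LocallyConvexSpace.sInf fun _ h => h.2.2.1,
    fun C => continuous_sInf_rng.2 fun _ h => h.2.2.2 C⟩

/-! ### Amplitudes and their operators -/

/-- The unit vectors of the variable `x` in `ℝ^{3d}`, whose points are written `(x, y, ξ)`. -/
def xVec (d : ℕ) (j : Fin d) : Rd d × Rd d × Rd d := (stdVec d j, 0, 0)

/-- The unit vectors of the variable `y` in `ℝ^{3d}`. -/
def yVec (d : ℕ) (j : Fin d) : Rd d × Rd d × Rd d := (0, stdVec d j, 0)

/-- The unit vectors of the variable `ξ` in `ℝ^{3d}`. -/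
def xiVec (d : ℕ) (j : Fin d) : Rd d × Rd d × Rd d := (0, 0, stdVec d j)

/-- The mixed derivative `∂_ξ^α ∂_x^β ∂_y^γ a`. -/
def mixedDeriv {d : ℕ} (α β γ : Fin d → ℕ) (a : Rd d × Rd d × Rd d → ℂ) :
    Rd d × Rd d × Rd d → ℂ :=
  multiDeriv (xiVec d) α (multiDeriv (xVec d) β (multiDeriv (yVec d) γ a))

/-- The amplitude class `APS_{ρ,δ}^{m,s}(ℝ^{3d})`. -/
structure IsAmplitude (d : ℕ) (ρ δ m s : ℝ) (a : Rd d × Rd d × Rd d → ℂ) : Prop where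
  contDiff : ContDiff ℝ ∞ a
  almostPeriodic : ∀ ξ : Rd d, IsAlmostPeriodic (fun p : Rd d × Rd d => a (p.1, p.2, ξ))
  estimates : ∃ C > (0 : ℝ), ∃ B > (0 : ℝ), ∃ M : ℕ, 0 < M ∧ (d : ℝ) / 2 < M ∧
    (∀ (α β γ : Fin d → ℕ) (x y ξ : Rd d), B * (order α : ℝ) ^ s ≤ japanese ξ →
      ‖mixedDeriv α β γ a (x, y, ξ)‖ ≤
        C ^ (1 + order α + order β + order γ) *
          ((multiFactorial β * multiFactorial γ : ℕ) : ℝ) ^ (s * (ρ - δ)) * multiFactorial α *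
          japanese ξ ^ (m - ρ * order α + δ * (order β + order γ))) ∧
    (∀ (α β γ : Fin d → ℕ) (x y ξ : Rd d), japanese ξ < B * (order α : ℝ) ^ s →
      order α ≤ 2 * M →
      ‖mixedDeriv α β γ a (x, y, ξ)‖ ≤
        C ^ (1 + order α + order β + order γ) *
          ((multiFactorial β * multiFactorial γ : ℕ) : ℝ) ^ (s * (ρ - δ)) * multiFactorial α)

/-- The cutoff functions: `χ ∈ C_c^∞(ℝ^d)` equal to one in a neighbourhood of the origin. -/
structure IsCutoff {d : ℕ} (χ : Rd d → ℂ) : Prop where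
  contDiff : ContDiff ℝ ∞ χ
  hasCompactSupport : HasCompactSupport χ
  eventually_eq_one : ∀ᶠ y in 𝓝 (0 : Rd d), χ y = 1

/-- The regularized integral
`∬ χ(εy) χ(εξ) e^{2πi ξ·(x-y)} a(x,y,ξ) f(y) dy dξ`
(for `ε ≠ 0` its integrand is continuous with compact support). -/
def regularizedIntegral {d : ℕ} (χ : Rd d → ℂ) (a : Rd d × Rd d × Rd d → ℂ) (f : Rd d → ℂ)
    (x : Rd d) (ε : ℝ) : ℂ :=
  ∫ p : Rd d × Rd d, χ (ε • p.1) * χ (ε • p.2) *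
    Complex.exp (2 * Real.pi * Complex.I * (inner ℝ p.2 (x - p.1) : ℝ)) *
    a (x, p.1, p.2) * f p.1

/-- `g = a(x,D) f`: for every `x` and every cutoff function `χ`, the regularized integrals
converge to `g x` as `ε → 0+`. -/
def IsOperatorValue {d : ℕ} (a : Rd d × Rd d × Rd d → ℂ) (f g : Rd d → ℂ) : Prop :=
  ∀ χ : Rd d → ℂ, IsCutoff χ → ∀ x : Rd d,
    Filter.Tendsto (regularizedIntegral χ a f x) (𝓝[>] (0 : ℝ)) (𝓝 (g x))

end GevreyAP

end

/-! Substitute `y = x - z` and put `u (x, z, ξ) = a (x, x - z, ξ) f (x - z)`. The regularized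
integral becomes an oscillatory integral of a cutoff times `u` against `e^{2πi ξ·z}`, and the whole
proposition rests on an absolutely convergent replacement for it.

Since `(1 + (2π)⁻¹ ∂_{z_j}) e^{2πi ξ·z} = (1 + i ξ_j) e^{2πi ξ·z}`, integrating by parts `m₀ + d +
1` times in each `z_j` produces powers of `(1 + i ξ_j)⁻¹` whose product absorbs the growth
`⟨ξ⟩^{m₀}` of the amplitude and leaves `⟨ξ⟩^{-(d+1)}`. The operator `1 + (-1)^M ∑ ∂_{ξ_j}^{2M}`
multiplies the exponential by `1 + ∑ (2π z_j)^{2M}`, whose inverse is integrable because `2M > d`.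
This costs `2M` derivatives in `ξ`, exactly those that the amplitude estimates control for every
`ξ`. The outcome is `reduce M m₀ u`, integrated against `kernel M` (`integral_reduce`,
`exists_reduce_bound`).

Limit: the same reduction applies to `u` times the cutoff, with bounds uniform in `ε`. As `reduce`
is local, both reductions agree where the cutoff is locally one, so the error is at most a constant
times the integral of a fixed integrable function over a set that recedes to infinity
(`exists_norm_sub_le`, `tendsto_integral_farSet`).

Gevrey bounds: differentiation in `x` passes under the integral, and sequences bounded by `A Cⁿ
(n!)^s` are stable under the Leibniz rule, under shifts and, as `s ≥ 1`, under multiplication by the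
resolvents. All constants depend on `f` only through its step and, linearly, its norm
(`exists_step_bound`). Each step is thus mapped boundedly into another one, which is continuity for
the inductive limit (`continuous_gap`).

Almost periodicity: with the cutoff placed on `z` instead of `y` the error is uniform in `x`. The
truncated integral runs over a compact set of parameters `(z, ξ)`, and its integrand is almost
periodic in `x` and continuous in the parameters uniformly in `x`. Bochner's criterion, in the form
of finite colourings of the translates, passes to such integrals (`FinitelyColored.integral`) and to
uniform limits. -/

namespace GevreyAP

/-! ### Iterated derivatives along lists of directions -/

section ListDeriv

variable {V V' : Type*} [NormedAddCommGroup V] [NormedSpace ℝ V]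
  [NormedAddCommGroup V'] [NormedSpace ℝ V']

/-- The iterated directional derivative along a list of directions, the head being applied
first. -/
noncomputable def listDeriv (l : List V) (f : V → ℂ) : V → ℂ :=
  l.foldl (fun g v => dirDeriv v g) f

theorem listDeriv_nil (f : V → ℂ) : listDeriv [] f = f := rfl

theorem listDeriv_cons (v : V) (l : List V) (f : V → ℂ) :
    listDeriv (v :: l) f = listDeriv l (dirDeriv v f) := rfl

theorem listDeriv_append (l l' : List V) (f : V → ℂ) :
    listDeriv (l ++ l') f = listDeriv l' (listDeriv l f) := List.foldl_append

theorem listDeriv_add (l : List V) {f g : V → ℂ} (hf : ContDiff ℝ ∞ f) (hg : ContDiff ℝ ∞ g) :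
    listDeriv l (f + g) = listDeriv l f + listDeriv l g := by
  induction l generalizing f g with
  | nil => rfl
  | cons v l ih =>
    simp only [listDeriv_cons, dirDeriv_add hf hg]
    exact ih (contDiff_dirDeriv hf) (contDiff_dirDeriv hg)

theorem listDeriv_smul (l : List V) (c : ℂ) {f : V → ℂ} (hf : ContDiff ℝ ∞ f) :
    listDeriv l (c • f) = c • listDeriv l f := by
  induction l generalizing f with
  | nil => rfl
  | cons v l ih =>
    simp only [listDeriv_cons, dirDeriv_smul c hf]
    exact ih (contDiff_dirDeriv hf)

theorem dirDeriv_comm (u v : V) {f : V → ℂ} (hf : ContDiff ℝ ∞ f) :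
    dirDeriv u (dirDeriv v f) = dirDeriv v (dirDeriv u f) := by
  funext x
  have h1 : ContDiff ℝ ∞ (fderiv ℝ f) := hf.fderiv_right (by simp)
  have hd : DifferentiableAt ℝ (fderiv ℝ f) x := (h1.differentiable (by simp)) x
  have key : ∀ a b : V, dirDeriv a (dirDeriv b f) x = fderiv ℝ (fderiv ℝ f) x a b := by
    intro a b
    unfold dirDeriv
    rw [fderiv_clm_apply hd (differentiableAt_const b)]
    simp
  have hs : IsSymmSndFDerivAt ℝ f x :=
    (hf.contDiffAt).isSymmSndFDerivAt (by simpa using WithTop.coe_le_coe.2 (le_top (a := (2 : ℕ∞))))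
  rw [key, key]
  exact hs u v

/-- Symmetry of second derivatives. Lists allow induction one derivative at a time, and this lemma
permits the return to multi-indices. -/
theorem listDeriv_perm {l l' : List V} (h : l.Perm l') {f : V → ℂ} (hf : ContDiff ℝ ∞ f) :
    listDeriv l f = listDeriv l' f := by
  induction h generalizing f with
  | nil => rfl
  | cons v _ ih => exact ih (contDiff_dirDeriv hf)
  | swap u v l =>
    simp only [listDeriv_cons]
    rw [dirDeriv_comm _ _ hf]
  | trans _ _ ih ih' => rw [ih hf, ih' hf]

theorem listDeriv_replicate (n : ℕ) (v : V) (f : V → ℂ) :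
    listDeriv (List.replicate n v) f = (dirDeriv v)^[n] f := by
  induction n generalizing f with
  | zero => rfl
  | succ n ih => rw [List.replicate_succ, listDeriv_cons, ih, Function.iterate_succ_apply]

/-- The list of directions containing `e j` exactly `α j` times. -/
def multiList {X : Type*} {d : ℕ} (e : Fin d → X) (α : Fin d → ℕ) : List X :=
  (List.finRange d).flatMap fun j => List.replicate (α j) (e j)

theorem length_multiList {X : Type*} {d : ℕ} (e : Fin d → X) (α : Fin d → ℕ) :
    (multiList e α).length = order α := by
  simp [multiList, order, List.length_flatMap, Fin.sum_univ_def]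

theorem multiDeriv_eq_listDeriv {d : ℕ} (e : Fin d → V) (α : Fin d → ℕ) {f : V → ℂ}
    (hf : ContDiff ℝ ∞ f) : multiDeriv e α f = listDeriv (multiList e α) f := by
  unfold multiDeriv multiList
  induction List.finRange d with
  | nil => rfl
  | cons j l ih =>
    rw [List.foldr_cons, ih, List.flatMap_cons, ← listDeriv_replicate, ← listDeriv_append]
    -- The fold in `multiDeriv` applies its head last, while `listDeriv` applies it first.
    exact listDeriv_perm List.perm_append_comm hf

theorem dirDeriv_comp_clm (L : V →L[ℝ] V') (v : V) {f : V' → ℂ} (hf : ContDiff ℝ ∞ f) :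
    dirDeriv v (f ∘ L) = dirDeriv (L v) f ∘ L := by
  funext x
  have h := (hf.differentiable (by simp)) (L x)
  simp [dirDeriv, fderiv_comp x h L.differentiableAt]

theorem dirDeriv_mul (v : V) {f g : V → ℂ} (hf : ContDiff ℝ ∞ f) (hg : ContDiff ℝ ∞ g) :
    dirDeriv v (f * g) = dirDeriv v f * g + f * dirDeriv v g := by
  funext x
  have h1 := (hf.differentiable (by simp)) x
  have h2 := (hg.differentiable (by simp)) x
  simp only [dirDeriv, Pi.add_apply, Pi.mul_apply]
  rw [fderiv_mul h1 h2]
  simp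
  ring

theorem dirDeriv_add_dir (u v : V) (f : V → ℂ) :
    dirDeriv (u + v) f = dirDeriv u f + dirDeriv v f := by
  funext x; simp [dirDeriv]

theorem dirDeriv_neg_dir (v : V) (f : V → ℂ) : dirDeriv (-v) f = (-1 : ℂ) • dirDeriv v f := by
  funext x; simp [dirDeriv]

theorem dirDeriv_zero_dir (f : V → ℂ) : dirDeriv 0 f = 0 := by
  funext x; simp [dirDeriv]

theorem listDeriv_zero (l : List V) : listDeriv l (0 : V → ℂ) = 0 := by
  have := listDeriv_smul l (0 : ℂ) (contDiff_const (c := (0 : ℂ)) : ContDiff ℝ ∞ (0 : V → ℂ))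
  simpa using this

theorem norm_listDeriv_le (l : List V) (hl : ∀ v ∈ l, ‖v‖ ≤ 1) {f : V → ℂ}
    (hf : ContDiff ℝ ∞ f) (x : V) :
    ‖listDeriv l f x‖ ≤ ‖iteratedFDeriv ℝ l.length f x‖ := by
  have key : ∀ (v : V), ‖v‖ ≤ 1 → ∀ {f : V → ℂ}, ContDiff ℝ ∞ f → ∀ n : ℕ,
      ‖iteratedFDeriv ℝ n (dirDeriv v f) x‖ ≤ ‖iteratedFDeriv ℝ (n + 1) f x‖ := by
    intro v hv f hf n
    have h1 : ContDiff ℝ ∞ (fderiv ℝ f) := hf.fderiv_right (by simp)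
    have h2 : dirDeriv v f = ContinuousLinearMap.apply ℝ ℂ v ∘ fderiv ℝ f := rfl
    have h3 : ‖ContinuousLinearMap.apply ℝ ℂ v‖ ≤ 1 :=
      ContinuousLinearMap.opNorm_le_bound _ zero_le_one fun L => by
        simpa [mul_comm] using (L.le_opNorm v).trans
          (mul_le_of_le_one_right (norm_nonneg L) hv)
    rw [h2, ← norm_iteratedFDeriv_fderiv]
    refine (ContinuousLinearMap.norm_iteratedFDeriv_comp_left _ (h1.contDiffAt (x := x))
      (n := n) (by exact_mod_cast le_top)).trans ?_
    exact mul_le_of_le_one_left (norm_nonneg _) h3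
  induction l generalizing f with
  | nil => simp [listDeriv_nil]
  | cons v l ih =>
    rw [listDeriv_cons]
    refine (ih (fun w hw => hl w (List.mem_cons_of_mem _ hw)) (contDiff_dirDeriv hf)).trans ?_
    exact key v (hl v List.mem_cons_self) hf _

theorem dirDeriv_congr {f g : V → ℂ} {x : V} (v : V) (h : f =ᶠ[𝓝 x] g) :
    dirDeriv v f =ᶠ[𝓝 x] dirDeriv v g := by
  filter_upwards [h.fderiv (𝕜 := ℝ)] with y hy
  simp [dirDeriv, hy]

theorem iterate_dirDeriv_congr {f g : V → ℂ} {x : V} (v : V) (n : ℕ) (h : f =ᶠ[𝓝 x] g) :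
    (dirDeriv v)^[n] f =ᶠ[𝓝 x] (dirDeriv v)^[n] g := by
  induction n with
  | zero => exact h
  | succ n ih => simp only [Function.iterate_succ_apply']; exact dirDeriv_congr v ih

end ListDeriv

/-! ### Gevrey sequences -/

/-- `G` is a nonnegative sequence with `G n ≤ A Cⁿ (n!)^s`. -/
def IsGevSeq (s : ℝ) (G : ℕ → ℝ) : Prop :=
  (∀ n, 0 ≤ G n) ∧ ∃ A > (0 : ℝ), ∃ C > (0 : ℝ), ∀ n, G n ≤ A * C ^ n * (n.factorial : ℝ) ^ s

/-- The binomial convolution of two sequences. -/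
def binConv (G G' : ℕ → ℝ) (n : ℕ) : ℝ :=
  ∑ ij ∈ Finset.HasAntidiagonal.antidiagonal n, (n.choose ij.1 : ℝ) * (G ij.1 * G' ij.2)

/-- The sequence `n ↦ G (n + 1)`. -/
def shift (G : ℕ → ℝ) (n : ℕ) : ℝ := G (n + 1)

/-- Pascal's rule. It matches one application of the Leibniz rule, and drives the induction in
`DerivBound.mul`. -/
theorem binConv_shift (G G' : ℕ → ℝ) (n : ℕ) :
    binConv (shift G) G' n + binConv G (shift G') n = binConv G G' (n + 1) := by
  unfold binConv shift
  rw [Finset.sum_antidiagonal_choose_succ_mul (fun i j => G i * G' j) n, add_comm]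
  congr 1
  refine Finset.sum_congr rfl fun ij hij => ?_
  rw [Nat.choose_symm_of_eq_add (Finset.HasAntidiagonal.mem_antidiagonal.1 hij).symm]

theorem binConv_nonneg {G G' : ℕ → ℝ} (hG : ∀ n, 0 ≤ G n) (hG' : ∀ n, 0 ≤ G' n) (n : ℕ) :
    0 ≤ binConv G G' n :=
  Finset.sum_nonneg fun _ _ => mul_nonneg (Nat.cast_nonneg _) (mul_nonneg (hG _) (hG' _))

/-- The binomial theorem sums the geometric factors to `(C + C')ⁿ`, and `i! j! ≤ (i + j)!` handles
the factorials. -/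
theorem IsGevSeq.binConv {s : ℝ} (hs : 0 ≤ s) {G G' : ℕ → ℝ} (h : IsGevSeq s G)
    (h' : IsGevSeq s G') : IsGevSeq s (binConv G G') := by
  obtain ⟨h0, A, hA, C, hC, hG⟩ := h
  obtain ⟨h0', A', hA', C', hC', hG'⟩ := h'
  refine ⟨binConv_nonneg h0 h0', A * A', by positivity, C + C', by positivity, fun n => ?_⟩
  have hexp : (C + C') ^ n =
      ∑ ij ∈ Finset.HasAntidiagonal.antidiagonal n, (n.choose ij.1 : ℝ) * (C ^ ij.1 * C' ^ ij.2) := by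
    rw [(Commute.all C C').add_pow']
    simp [nsmul_eq_mul]
  rw [hexp, Finset.mul_sum, Finset.sum_mul]
  refine Finset.sum_le_sum fun ij hij => ?_
  have hn : ij.1 + ij.2 = n := Finset.HasAntidiagonal.mem_antidiagonal.1 hij
  have hf : (ij.1.factorial : ℝ) ^ s * (ij.2.factorial : ℝ) ^ s ≤ (n.factorial : ℝ) ^ s := by
    rw [← Real.mul_rpow (by positivity) (by positivity)]
    refine Real.rpow_le_rpow (by positivity) ?_ hs
    rw [← hn]
    exact_mod_cast Nat.le_of_dvd (Nat.factorial_pos _) (Nat.factorial_mul_factorial_dvd_factorial_add _ _)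
  calc (n.choose ij.1 : ℝ) * (G ij.1 * G' ij.2)
      ≤ (n.choose ij.1 : ℝ) * ((A * C ^ ij.1 * (ij.1.factorial : ℝ) ^ s) *
          (A' * C' ^ ij.2 * (ij.2.factorial : ℝ) ^ s)) :=
        mul_le_mul_of_nonneg_left (mul_le_mul (hG _) (hG' _) (h0' _) ((h0 _).trans (hG _)))
          (Nat.cast_nonneg _)
    _ = (A * A' * ((n.choose ij.1 : ℝ) * (C ^ ij.1 * C' ^ ij.2))) *
          ((ij.1.factorial : ℝ) ^ s * (ij.2.factorial : ℝ) ^ s) := by ring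
    _ ≤ _ := mul_le_mul_of_nonneg_left hf (by positivity)

theorem IsGevSeq.shift {s : ℝ} (hs : 0 ≤ s) {G : ℕ → ℝ} (h : IsGevSeq s G) :
    IsGevSeq s (shift G) := by
  obtain ⟨h0, A, hA, C, hC, hG⟩ := h
  refine ⟨fun n => h0 _, A * C, by positivity, C * 2 ^ s, by positivity, fun n => ?_⟩
  -- The extra factor `(n + 1)^s` is absorbed into the geometric constant through `n + 1 ≤ 2ⁿ`.
  have hf : ((n + 1).factorial : ℝ) ^ s ≤ (2 ^ s) ^ n * (n.factorial : ℝ) ^ s := by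
    have h1 : (((2 : ℝ) ^ s) ^ n) = ((2 : ℝ) ^ n) ^ s := by
      rw [← Real.rpow_natCast, ← Real.rpow_natCast, ← Real.rpow_mul zero_le_two,
        ← Real.rpow_mul zero_le_two, mul_comm]
    rw [h1, ← Real.mul_rpow (by positivity) (by positivity)]
    refine Real.rpow_le_rpow (by positivity) ?_ hs
    rw [Nat.factorial_succ]
    exact_mod_cast Nat.mul_le_mul_right _ (Nat.lt_two_pow_self (n := n))
  calc G (n + 1) ≤ A * C ^ (n + 1) * ((n + 1).factorial : ℝ) ^ s := hG _
    _ ≤ A * C ^ (n + 1) * ((2 ^ s) ^ n * (n.factorial : ℝ) ^ s) :=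
        mul_le_mul_of_nonneg_left hf (by positivity)
    _ = _ := by rw [mul_pow]; ring

theorem IsGevSeq.iterate_shift {s : ℝ} (hs : 0 ≤ s) (k : ℕ) {G : ℕ → ℝ} (h : IsGevSeq s G) :
    IsGevSeq s (GevreyAP.shift^[k] G) := by
  induction k with
  | zero => exact h
  | succ k ih => rw [Function.iterate_succ_apply']; exact ih.shift hs

theorem IsGevSeq.pow_mul {s : ℝ} {κ : ℝ} (hκ : 0 < κ) {G : ℕ → ℝ} (h : IsGevSeq s G) :
    IsGevSeq s (fun n => κ ^ n * G n) := by
  obtain ⟨h0, A, hA, C, hC, hG⟩ := h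
  refine ⟨fun n => mul_nonneg (by positivity) (h0 _), A, hA, κ * C, by positivity, fun n => ?_⟩
  calc κ ^ n * G n ≤ κ ^ n * (A * C ^ n * (n.factorial : ℝ) ^ s) :=
        mul_le_mul_of_nonneg_left (hG n) (by positivity)
    _ = _ := by rw [mul_pow]; ring

theorem IsGevSeq.add_const_mul {s : ℝ} {c : ℝ} (hc : 0 ≤ c) {G G' : ℕ → ℝ} (h : IsGevSeq s G)
    (h' : IsGevSeq s G') : IsGevSeq s (fun n => G n + c * G' n) := by
  obtain ⟨h0, A, hA, C, hC, hG⟩ := h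
  obtain ⟨h0', A', hA', C', hC', hG'⟩ := h'
  refine ⟨fun n => add_nonneg (h0 _) (mul_nonneg hc (h0' _)), A + c * A', by positivity, C + C',
    by positivity, fun n => ?_⟩
  have h1 : C ^ n ≤ (C + C') ^ n := pow_le_pow_left₀ hC.le (by linarith) n
  have h2 : C' ^ n ≤ (C + C') ^ n := pow_le_pow_left₀ hC'.le (by linarith) n
  calc G n + c * G' n ≤ A * C ^ n * (n.factorial : ℝ) ^ s
        + c * (A' * C' ^ n * (n.factorial : ℝ) ^ s) :=
        add_le_add (hG n) (mul_le_mul_of_nonneg_left (hG' n) hc)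
    _ ≤ A * (C + C') ^ n * (n.factorial : ℝ) ^ s
        + c * (A' * (C + C') ^ n * (n.factorial : ℝ) ^ s) := by gcongr
    _ = _ := by ring

theorem isGevSeq_factorial {s : ℝ} (hs : 1 ≤ s) : IsGevSeq s (fun n => (n.factorial : ℝ)) := by
  refine ⟨fun n => by positivity, 1, one_pos, 1, one_pos, fun n => ?_⟩
  have h1 : (1 : ℝ) ≤ n.factorial := by exact_mod_cast Nat.factorial_pos n
  simpa using Real.self_le_rpow_of_one_le h1 hs

/-! ### Derivative bounds on `ℝ^{3d}` -/

/-- Points `(x, z, ξ)`. -/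
abbrev Rd3 (d : ℕ) : Type := Rd d × Rd d × Rd d

/-- Labels of the coordinates of `ℝ^{3d}`. -/
abbrev Var (d : ℕ) : Type := Fin d ⊕ Fin d ⊕ Fin d

/-- The coordinate directions of `ℝ^{3d}`. -/
noncomputable def dir {d : ℕ} : Var d → Rd3 d := Sum.elim (xVec d) (Sum.elim (yVec d) (xiVec d))

/-- Whether a coordinate belongs to `ξ`. -/
def isXi {d : ℕ} : Var d → Bool := Sum.elim (fun _ => false) (Sum.elim (fun _ => false) fun _ => true)

/-- The number of `ξ`-coordinates in a list. -/
def xiCount {d : ℕ} (l : List (Var d)) : ℕ := l.countP isXi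

theorem xiCount_cons {d : ℕ} (i : Var d) (l : List (Var d)) :
    xiCount (i :: l) = xiCount l + (if isXi i then 1 else 0) := List.countP_cons

/-- The derivatives of `u` of order at most `r` in `ξ` and of any order in the other variables are
bounded by `G n * W`, where `n` is the total order. -/
structure DerivBound {d : ℕ} (r : ℕ) (G : ℕ → ℝ) (W : Rd3 d → ℝ) (u : Rd3 d → ℂ) : Prop where
  contDiff : ContDiff ℝ ∞ u
  bound : ∀ l : List (Var d), xiCount l ≤ r → ∀ v,
    ‖listDeriv (l.map dir) u v‖ ≤ G l.length * W v

namespace DerivBound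

variable {d r r' : ℕ} {G G' : ℕ → ℝ} {W W' : Rd3 d → ℝ} {u u' : Rd3 d → ℂ}

theorem of_le (h : DerivBound r G W u) (hr : r' ≤ r) : DerivBound r' G W u :=
  ⟨h.contDiff, fun l hl v => h.bound l (hl.trans hr) v⟩

theorem mono (h : DerivBound r G W u) (hW : ∀ v, 0 ≤ W v) (hG : ∀ n, G n ≤ G' n) :
    DerivBound r G' W u :=
  ⟨h.contDiff, fun l hl v => (h.bound l hl v).trans (mul_le_mul_of_nonneg_right (hG _) (hW v))⟩

theorem mono_weight (h : DerivBound r G W u) (hG : ∀ n, 0 ≤ G n) (hW : ∀ v, W v ≤ W' v) :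
    DerivBound r G W' u :=
  ⟨h.contDiff, fun l hl v => (h.bound l hl v).trans (mul_le_mul_of_nonneg_left (hW v) (hG _))⟩

theorem norm_le (h : DerivBound r G W u) (v : Rd3 d) : ‖u v‖ ≤ G 0 * W v :=
  h.bound [] (Nat.zero_le _) v

/-- Only a derivative in `ξ` uses up one of the `r` available orders; `x` and `z` derivatives are
free. -/
theorem dirDeriv (h : DerivBound r G W u) (i : Var d) (hi : r' + (if isXi i then 1 else 0) ≤ r) :
    DerivBound r' (shift G) W (dirDeriv (dir i) u) :=
  ⟨contDiff_dirDeriv h.contDiff, fun l hl v => by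
    have := h.bound (i :: l) (by rw [xiCount_cons]; omega) v
    exact this⟩

theorem iterate_dirDeriv (i : Var d) (n : ℕ) {G : ℕ → ℝ} {r : ℕ} {u : Rd3 d → ℂ}
    (h : DerivBound r G W u) (hr : r' + n ≤ r) :
    DerivBound r' (GevreyAP.shift^[n] G) W ((GevreyAP.dirDeriv (dir i))^[n] u) := by
  induction n generalizing G r u with
  | zero => exact h.of_le (by omega)
  | succ n ih =>
    rw [Function.iterate_succ_apply, Function.iterate_succ_apply]
    exact ih (h.dirDeriv i (r' := r' + n) (by split_ifs <;> omega)) le_rfl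

theorem add (h : DerivBound r G W u) (h' : DerivBound r G' W u') :
    DerivBound r (fun n => G n + G' n) W (u + u') :=
  ⟨h.contDiff.add h'.contDiff, fun l hl v => by
    rw [listDeriv_add _ h.contDiff h'.contDiff, add_mul]
    exact (norm_add_le _ _).trans (add_le_add (h.bound l hl v) (h'.bound l hl v))⟩

theorem smul (c : ℂ) (h : DerivBound r G W u) : DerivBound r (fun n => ‖c‖ * G n) W (c • u) :=
  ⟨h.contDiff.const_smul c, fun l hl v => by
    rw [listDeriv_smul _ c h.contDiff, Pi.smul_apply, norm_smul, mul_assoc]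
    exact mul_le_mul_of_nonneg_left (h.bound l hl v) (norm_nonneg c)⟩

theorem zero (hG : ∀ n, 0 ≤ G n) (hW : ∀ v, 0 ≤ W v) : DerivBound r G W (0 : Rd3 d → ℂ) :=
  ⟨contDiff_const, fun l _ v => by
    rw [listDeriv_zero]; simpa using mul_nonneg (hG _) (hW v)⟩

theorem add_smul (c : ℂ) (h : DerivBound r G W u) (h' : DerivBound r G' W u') :
    DerivBound r (fun n => G n + ‖c‖ * G' n) W (u + c • u') := h.add (h'.smul c)

theorem sum {ι : Type*} (S : Finset ι) {f : ι → Rd3 d → ℂ}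
    (hW : ∀ v, 0 ≤ W v) (h : ∀ i, DerivBound r G W (f i)) :
    DerivBound r (fun n => S.card * G n) W (∑ i ∈ S, f i) := by
  classical
  induction S using Finset.induction_on with
  | empty =>
    simpa using zero (r := r) (G := fun _ => 0) (fun _ => le_rfl) hW
  | insert i S hi ih =>
    rw [Finset.sum_insert hi]
    refine ((h i).add ih).mono hW fun n => ?_
    rw [Finset.card_insert_of_notMem hi]
    push_cast
    linarith

/-- Leibniz rule by induction on the list: the first derivative falls on one factor and shifts its
sequence, and `binConv_shift` recombines the two terms. -/
theorem mul (h : DerivBound r G W u) (h' : DerivBound r G' W' u') :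
    DerivBound r (binConv G G') (fun v => W v * W' v) (u * u') := by
  refine ⟨h.contDiff.mul h'.contDiff, fun l hl v => ?_⟩
  induction l generalizing r G G' u u' with
  | nil =>
    simp only [List.map_nil, listDeriv_nil, Pi.mul_apply, norm_mul, List.length_nil, binConv,
      Finset.HasAntidiagonal.antidiagonal_zero, Finset.sum_singleton, Nat.choose_self, Nat.cast_one, one_mul]
    calc ‖u v‖ * ‖u' v‖ ≤ (G 0 * W v) * (G' 0 * W' v) :=
          mul_le_mul (h.norm_le v) (h'.norm_le v) (norm_nonneg _)
            ((norm_nonneg _).trans (h.norm_le v))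
      _ = _ := by ring
  | cons i l ih =>
    rw [xiCount_cons] at hl
    have hr : xiCount l + (if isXi i then 1 else 0) ≤ r := hl
    have h1 := ih (h.dirDeriv i hr) (h'.of_le (r' := xiCount l) (by omega)) le_rfl
    have h2 := ih (h.of_le (r' := xiCount l) (by omega)) (h'.dirDeriv i hr) le_rfl
    rw [List.map_cons, listDeriv_cons, dirDeriv_mul _ h.contDiff h'.contDiff,
      listDeriv_add _ (show ContDiff ℝ ∞ (GevreyAP.dirDeriv (dir i) u * u') from
          (contDiff_dirDeriv h.contDiff).mul h'.contDiff)
        (show ContDiff ℝ ∞ (u * GevreyAP.dirDeriv (dir i) u') from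
          h.contDiff.mul (contDiff_dirDeriv h'.contDiff)), List.length_cons, ← binConv_shift,
      add_mul]
    exact (norm_add_le _ _).trans (add_le_add h1 h2)

end DerivBound

/-! ### Lists of coordinates versus multi-indices -/

theorem map_multiList {X Y : Type*} {d : ℕ} (g : X → Y) (e : Fin d → X) (α : Fin d → ℕ) :
    (multiList e α).map g = multiList (g ∘ e) α := by
  simp [multiList, List.map_flatMap]

theorem count_multiList {X : Type*} [BEq X] [LawfulBEq X] [DecidableEq X] {d : ℕ} (e : Fin d → X) (α : Fin d → ℕ)
    (x : X) : (multiList e α).count x = ∑ j, if e j = x then α j else 0 := by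
  simp [multiList, List.count_flatMap, List.count_replicate, Fin.sum_univ_def, Function.comp_def]

/-- Needed to count the labels of type `Var d` in a list. -/
instance {X Y : Type*} [BEq X] [BEq Y] [LawfulBEq X] [LawfulBEq Y] : LawfulBEq (X ⊕ Y) where
  eq_of_beq {a b} h := by
    rcases a with a | a <;> rcases b with b | b
    · exact congrArg Sum.inl (eq_of_beq (α := X) h)
    · cases h
    · cases h
    · exact congrArg Sum.inr (eq_of_beq (α := Y) h)
  rfl {a} := by
    rcases a with a | a
    · exact beq_self_eq_true (α := X) a
    · exact beq_self_eq_true (α := Y) a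

theorem perm_multiList {d : ℕ} (l : List (Fin d)) :
    l.Perm (multiList id fun j => l.count j) := by
  rw [List.perm_iff_count]
  intro j
  simp [count_multiList]

/-- The order `y`, `x`, `ξ` of the blocks is the order in which `mixedDeriv` applies its
derivatives. -/
theorem perm_multiList_var {d : ℕ} (l : List (Var d)) :
    l.Perm (multiList (fun j => Sum.inr (Sum.inl j)) (fun j => l.count (Sum.inr (Sum.inl j))) ++
      multiList Sum.inl (fun j => l.count (Sum.inl j)) ++
      multiList (fun j => Sum.inr (Sum.inr j)) (fun j => l.count (Sum.inr (Sum.inr j)))) := by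
  rw [List.perm_iff_count]
  intro i
  rcases i with j | j | j <;> simp [count_multiList]

theorem xiCount_multiList {d : ℕ} (l : List (Var d)) :
    xiCount l = order (fun j => l.count (Sum.inr (Sum.inr j))) := by
  have h : ∀ (e : Fin d → Var d) (α : Fin d → ℕ) (b : Bool), (∀ j, isXi (e j) = b) →
      xiCount (multiList e α) = if b then order α else 0 := by
    intro e α b hb
    simp [xiCount, multiList, List.countP_flatMap, List.countP_replicate, hb, order,
      Fin.sum_univ_def, Function.comp_def]
    split_ifs <;> simp
  have h1 : xiCount l = _ := (perm_multiList_var l).countP_eq isXi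
  rw [h1]
  simp only [List.countP_append]
  change xiCount _ + xiCount _ + xiCount _ = _
  rw [h _ _ false fun j => rfl, h _ _ false fun j => rfl, h _ _ true fun j => rfl]
  simp

theorem multiFactorial_dvd {d : ℕ} (α : Fin d → ℕ) : multiFactorial α ∣ (order α).factorial :=
  Nat.prod_factorial_dvd_factorial_sum _ _

theorem multiFactorial_le {d : ℕ} (α : Fin d → ℕ) : multiFactorial α ≤ (order α).factorial :=
  Nat.le_of_dvd (Nat.factorial_pos _) (multiFactorial_dvd α)

/-- A multinomial coefficient is at most exponential in `|α|`: peel off one index at a time, with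
`choose ≤ 2^(sum)`. This converts bounds in `|α|!` back to bounds in `α!`. -/
theorem factorial_order_le {d : ℕ} (α : Fin d → ℕ) :
    (order α).factorial ≤ (2 ^ d) ^ order α * multiFactorial α := by
  have key : ∀ S : Finset (Fin d), (∑ j ∈ S, α j).factorial ≤
      (2 ^ S.card) ^ (∑ j ∈ S, α j) * ∏ j ∈ S, (α j).factorial := by
    intro S
    induction S using Finset.induction_on with
    | empty => simp
    | insert i S hi ih =>
      rw [Finset.sum_insert hi, Finset.prod_insert hi, Finset.card_insert_of_notMem hi]
      set n := ∑ j ∈ S, α j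
      have h1 := Nat.add_choose_mul_factorial_mul_factorial (α i) n
      have h2 : (α i + n).choose n ≤ 2 ^ (α i + n) := Nat.choose_le_two_pow _ _
      rw [← h1]
      calc (α i + n).choose n * (α i).factorial * n.factorial
          ≤ 2 ^ (α i + n) * (α i).factorial *
            ((2 ^ S.card) ^ (α i + n) * ∏ j ∈ S, (α j).factorial) := by
            refine Nat.mul_le_mul (Nat.mul_le_mul_right _ h2) (ih.trans (Nat.mul_le_mul_right _ ?_))
            exact Nat.pow_le_pow_right (by positivity) (by omega)
        _ = _ := by rw [pow_succ 2 S.card, mul_pow]; ring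
  simpa [order, multiFactorial] using key Finset.univ

theorem order_count {d : ℕ} (l : List (Fin d)) : order (fun j => l.count j) = l.length := by
  rw [← length_multiList id, ← (perm_multiList l).length_eq]

theorem one_le_japanese {d : ℕ} (ξ : Rd d) : 1 ≤ japanese ξ := by
  unfold japanese
  rw [Real.one_le_sqrt]
  nlinarith [sq_nonneg ‖ξ‖]

/-! ### Gevrey functions and amplitudes as derivative bounds -/

/-- The iterated derivatives of a Gevrey function along lists of standard basis vectors. -/
theorem Step.norm_listDeriv_le {d : ℕ} {s : ℝ} (hs : 0 ≤ s) {C : {C : ℝ // 0 < C}}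
    (f : Step d s C) (l : List (Fin d)) (x : Rd d) :
    ‖listDeriv (l.map (stdVec d)) f.1 x‖ ≤
      (C.1 ^ l.length * (l.length.factorial : ℝ) ^ s) * ‖f‖ := by
  have hf : ContDiff ℝ ∞ f.1 := MemStep.contDiff f.2
  have h := f.weighted_le_norm (fun j => l.count j, x)
  unfold weighted at h
  have hw := weight_pos s C.2 (fun j => l.count j)
  rw [inv_mul_le_iff₀ hw] at h
  rw [listDeriv_perm ((perm_multiList l).map _) hf, map_multiList]
  simp only [Function.comp_id]
  rw [← multiDeriv_eq_listDeriv _ _ hf]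
  refine h.trans (mul_le_mul_of_nonneg_right ?_ (norm_nonneg f))
  simp only [order_count]
  refine mul_le_mul_of_nonneg_left (Real.rpow_le_rpow (by positivity) ?_ hs)
    (pow_nonneg C.2.le _)
  have := multiFactorial_le (fun j => l.count j)
  rw [order_count] at this
  exact_mod_cast this

/-- For at most `2M` derivatives in `ξ` the two regimes of the amplitude estimates merge into one:
`α!` becomes the constant `(2M)!`, and the gain `⟨ξ⟩^{-ρ|α|}` is discarded. -/
theorem IsAmplitude.exists_derivBound {d : ℕ} {ρ m s : ℝ} (hρ : 0 < ρ) (hρ1 : ρ ≤ 1) (hs : 1 ≤ s)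
    {a : Rd3 d → ℂ} (ha : IsAmplitude d ρ 0 m s a) :
    ∃ (M m₀ : ℕ) (G : ℕ → ℝ), 0 < M ∧ d < 2 * M ∧ IsGevSeq s G ∧
      DerivBound (2 * M) G (fun v => japanese v.2.2 ^ m₀) a := by
  obtain ⟨C, hC, B, hB, M, hM, hdM, h1, h2⟩ := ha.estimates
  -- A nonnegative integer exponent, so that `⟨ξ⟩^{m₀}` dominates both `⟨ξ⟩^m` and the constant
  -- weight `1` of the low-frequency regime.
  obtain ⟨m₀, hm₀⟩ := exists_nat_ge m
  refine ⟨M, m₀, fun n => C * (2 * M).factorial * C ^ n * (n.factorial : ℝ) ^ s, hM, ?_,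
    ⟨fun n => by positivity, C * (2 * M).factorial, by positivity, C, hC, fun n => le_rfl⟩,
    ha.contDiff, fun l hl v => ?_⟩
  · have : (d : ℝ) < 2 * M := by linarith
    exact_mod_cast this
  set α : Fin d → ℕ := fun j => l.count (Sum.inr (Sum.inr j)) with hα
  set β : Fin d → ℕ := fun j => l.count (Sum.inl j) with hβ
  set γ : Fin d → ℕ := fun j => l.count (Sum.inr (Sum.inl j)) with hγ
  have hperm := perm_multiList_var l
  have hlen : l.length = order α + order β + order γ := by
    rw [hperm.length_eq]
    simp only [List.length_append, length_multiList, hα, hβ, hγ]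
    omega
  have hD : listDeriv (l.map dir) a = mixedDeriv α β γ a := by
    unfold mixedDeriv
    rw [multiDeriv_eq_listDeriv _ α (contDiff_multiDeriv (contDiff_multiDeriv ha.contDiff)),
      multiDeriv_eq_listDeriv _ β (contDiff_multiDeriv ha.contDiff),
      multiDeriv_eq_listDeriv _ γ ha.contDiff, ← listDeriv_append, ← listDeriv_append,
      listDeriv_perm (hperm.map _) ha.contDiff]
    simp only [List.map_append, map_multiList, List.append_assoc]
    rfl
  have hα2 : order α ≤ 2 * M := by rw [← xiCount_multiList]; exact hl
  rw [hD]
  obtain ⟨x, y, ξ⟩ := v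
  have hj : 1 ≤ japanese ξ := one_le_japanese ξ
  have hj0 : 0 < japanese ξ := by linarith
  -- Gevrey order `s ρ` in `x` and `y` is at most order `s`, because `ρ ≤ 1`.
  have hfac : ((multiFactorial β * multiFactorial γ : ℕ) : ℝ) ^ (s * (ρ - 0)) ≤
      (l.length.factorial : ℝ) ^ s := by
    have e1 : (1 : ℝ) ≤ ((multiFactorial β * multiFactorial γ : ℕ) : ℝ) := by
      have hb := multiFactorial_pos β
      have hc := multiFactorial_pos γ
      exact_mod_cast Nat.mul_pos (by exact_mod_cast hb) (by exact_mod_cast hc)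
    have e2 : multiFactorial β * multiFactorial γ ≤ l.length.factorial := by
      refine (Nat.mul_le_mul (multiFactorial_le β) (multiFactorial_le γ)).trans ?_
      refine (Nat.le_of_dvd (Nat.factorial_pos _)
        (Nat.factorial_mul_factorial_dvd_factorial_add _ _)).trans ?_
      exact Nat.factorial_le (by omega)
    refine (Real.rpow_le_rpow_of_exponent_le e1 (show s * (ρ - 0) ≤ s by nlinarith)).trans ?_
    exact Real.rpow_le_rpow (by linarith) (by exact_mod_cast e2) (by linarith)
  have hfα : (multiFactorial α : ℝ) ≤ (2 * M).factorial := by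
    exact_mod_cast (multiFactorial_le α).trans (Nat.factorial_le hα2)
  have hpow : C ^ (1 + order α + order β + order γ) = C * C ^ l.length := by
    rw [hlen, ← pow_succ']; congr 1; omega
  have hmain : C ^ (1 + order α + order β + order γ) *
      ((multiFactorial β * multiFactorial γ : ℕ) : ℝ) ^ (s * (ρ - 0)) * multiFactorial α ≤
      C * (2 * M).factorial * C ^ l.length * (l.length.factorial : ℝ) ^ s := by
    rw [hpow]
    calc C * C ^ l.length * ((multiFactorial β * multiFactorial γ : ℕ) : ℝ) ^ (s * (ρ - 0)) *
          multiFactorial α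
        ≤ C * C ^ l.length * (l.length.factorial : ℝ) ^ s * (2 * M).factorial :=
          mul_le_mul (mul_le_mul_of_nonneg_left hfac (by positivity)) hfα (by positivity)
            (by positivity)
      _ = _ := by ring
  rcases le_or_gt (B * (order α : ℝ) ^ s) (japanese ξ) with hc | hc
  · refine (h1 α β γ x y ξ hc).trans (mul_le_mul hmain ?_ (by positivity) (by positivity))
    rw [← Real.rpow_natCast]
    refine Real.rpow_le_rpow_of_exponent_le hj ?_
    have : 0 ≤ ρ * order α := by positivity
    linarith
  · refine ((h2 α β γ x y ξ hc hα2).trans hmain).trans (le_mul_of_one_le_right (by positivity) ?_)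
    exact one_le_pow₀ hj

/-! ### Examples of functions with derivative bounds -/

/-- A single derivative in `x` or `ξ` annihilates the function, so only pure middle-variable lists
contribute. -/
theorem DerivBound.of_middle {d r : ℕ} {G : ℕ → ℝ} {t : ℝ} (hG : ∀ n, 0 ≤ G n) (ht : 0 ≤ t)
    {f : Rd d → ℂ} (hf : ContDiff ℝ ∞ f)
    (h : ∀ (l : List (Fin d)) (y : Rd d),
      ‖listDeriv (l.map (stdVec d)) f y‖ ≤ G l.length * t) :
    DerivBound r G (fun _ => t) (fun v : Rd3 d => f v.2.1) := by
  let L : Rd3 d →L[ℝ] Rd d :=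
    (ContinuousLinearMap.fst ℝ _ _).comp (ContinuousLinearMap.snd ℝ _ _)
  refine ⟨hf.comp L.contDiff, fun l hl v => ?_⟩
  clear hl
  change ‖listDeriv (l.map dir) (f ∘ L) v‖ ≤ _
  induction l generalizing f G with
  | nil => exact h [] _
  | cons i l ih =>
    rw [List.map_cons, listDeriv_cons, dirDeriv_comp_clm L _ hf]
    have hzero : L (dir i) = 0 →
        ‖listDeriv (l.map dir) (GevreyAP.dirDeriv (L (dir i)) f ∘ L) v‖ ≤ G (i :: l).length * t := by
      intro h0
      rw [h0, dirDeriv_zero_dir]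
      change ‖listDeriv _ (0 : Rd3 d → ℂ) v‖ ≤ _
      rw [listDeriv_zero]
      simpa using mul_nonneg (hG _) ht
    rcases i with j | j | j
    · exact hzero rfl
    · exact ih (G := shift G) (fun n => hG _) (contDiff_dirDeriv hf) fun l y => h (j :: l) y
    · exact hzero rfl

/-- The change of variables `(x, z, ξ) ↦ (x, x - z, ξ)`. -/
noncomputable def shear (d : ℕ) : Rd3 d →L[ℝ] Rd3 d :=
  (ContinuousLinearMap.fst ℝ (Rd d) (Rd d × Rd d)).prod
    (ContinuousLinearMap.prod (ContinuousLinearMap.fst ℝ (Rd d) (Rd d × Rd d) -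
      (ContinuousLinearMap.fst ℝ (Rd d) (Rd d)).comp
        (ContinuousLinearMap.snd ℝ (Rd d) (Rd d × Rd d)))
      ((ContinuousLinearMap.snd ℝ (Rd d) (Rd d)).comp
        (ContinuousLinearMap.snd ℝ (Rd d) (Rd d × Rd d))))

theorem shear_apply {d : ℕ} (v : Rd3 d) : shear d v = (v.1, v.1 - v.2.1, v.2.2) := rfl

theorem shear_x {d : ℕ} (j : Fin d) :
    shear d (dir (.inl j)) = dir (.inl j) + dir (.inr (.inl j)) := by
  simp [shear_apply, dir, xVec, yVec]

theorem shear_z {d : ℕ} (j : Fin d) : shear d (dir (.inr (.inl j))) = -dir (.inr (.inl j)) := by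
  simp [shear_apply, dir, yVec]

theorem shear_xi {d : ℕ} (j : Fin d) : shear d (dir (.inr (.inr j))) = dir (.inr (.inr j)) := by
  simp [shear_apply, dir, xiVec]

/-- The shear sends an `x` direction to a sum of two coordinate directions, so each derivative costs
a factor of at most two; the number of `ξ` derivatives is preserved. -/
theorem DerivBound.comp_shear {d r : ℕ} {G : ℕ → ℝ} {W : Rd3 d → ℝ} {u : Rd3 d → ℂ}
    (hG : ∀ n, 0 ≤ G n) (hW : ∀ v, 0 ≤ W v) (h : DerivBound r G W u) :
    DerivBound r (fun n => 2 ^ n * G n) (fun v => W (shear d v)) (u ∘ shear d) := by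
  refine ⟨h.contDiff.comp (shear d).contDiff, fun l hl v => ?_⟩
  induction l generalizing r G u with
  | nil => simpa [listDeriv_nil] using h.norm_le (shear d v)
  | cons i l ih =>
    rw [xiCount_cons] at hl
    rw [List.map_cons, listDeriv_cons, dirDeriv_comp_clm _ _ h.contDiff]
    have hd : ∀ i : Var d, xiCount l + (if isXi i then 1 else 0) ≤ r → _ :=
      fun i hi => h.dirDeriv i hi
    have key : DerivBound (xiCount l) (fun n => 2 * shift G n) W
        (GevreyAP.dirDeriv (shear d (dir i)) u) := by
      rcases i with j | j | j
      · rw [shear_x, dirDeriv_add_dir]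
        exact ((hd _ hl).add (hd (.inr (.inl j)) hl)).mono hW fun n => by linarith
      · rw [shear_z, dirDeriv_neg_dir]
        refine ((hd _ hl).smul (-1)).mono hW fun n => ?_
        have : 0 ≤ shift G n := hG _
        simp only [norm_neg, norm_one]
        linarith
      · rw [shear_xi]
        refine (hd _ hl).mono hW fun n => ?_
        have : 0 ≤ shift G n := hG _
        linarith
    refine (ih (fun n => mul_nonneg zero_le_two (hG _)) key le_rfl).trans (le_of_eq ?_)
    simp only [List.length_cons]
    ring

/-! ### Derivative bounds for the resolvents and the cutoffs -/

/-- The linear form `v ↦ ξ_j`. -/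
noncomputable def xiCoord {d : ℕ} (j : Fin d) : Rd3 d →L[ℝ] ℝ :=
  (EuclideanSpace.proj j).comp
    ((ContinuousLinearMap.snd ℝ _ _).comp (ContinuousLinearMap.snd ℝ _ _))

theorem xiCoord_apply {d : ℕ} (j : Fin d) (v : Rd3 d) : xiCoord j v = v.2.2 j := rfl

theorem abs_xiCoord_dir_le {d : ℕ} (j : Fin d) (i : Var d) : |xiCoord j (dir i)| ≤ 1 := by
  rcases i with k | k | k
  · simp [xiCoord_apply, dir, xVec]
  · simp [xiCoord_apply, dir, yVec]
  · by_cases h : j = k <;> simp [xiCoord_apply, dir, xiVec, stdVec, h]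

/-- The function `(1 + i ξ_j)⁻¹`. -/
noncomputable def resolvent {d : ℕ} (j : Fin d) (v : Rd3 d) : ℂ :=
  (1 + Complex.I * (v.2.2 j : ℝ))⁻¹

theorem one_add_I_mul_ne_zero (t : ℝ) : (1 + Complex.I * (t : ℂ)) ≠ 0 := by
  intro h
  have := congrArg Complex.re h
  simp at this

theorem norm_one_add_I_mul (t : ℝ) : ‖1 + Complex.I * (t : ℂ)‖ = Real.sqrt (1 + t ^ 2) := by
  rw [Complex.norm_def, Complex.normSq_apply]
  simp [sq]

theorem norm_resolvent {d : ℕ} (j : Fin d) (v : Rd3 d) :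
    ‖resolvent j v‖ = (Real.sqrt (1 + v.2.2 j ^ 2))⁻¹ := by
  rw [resolvent, norm_inv, norm_one_add_I_mul]

theorem norm_resolvent_le_one {d : ℕ} (j : Fin d) (v : Rd3 d) : ‖resolvent j v‖ ≤ 1 := by
  rw [norm_resolvent]
  refine inv_le_one_of_one_le₀ ?_
  rw [Real.one_le_sqrt]
  nlinarith [sq_nonneg (v.2.2 j)]

theorem contDiff_one_add_I_mul {d : ℕ} (j : Fin d) :
    ContDiff ℝ ∞ (fun v : Rd3 d => 1 + Complex.I * (v.2.2 j : ℝ)) :=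
  contDiff_const.add (contDiff_const.mul (Complex.ofRealCLM.contDiff.comp (xiCoord j).contDiff))

theorem contDiff_resolvent {d : ℕ} (j : Fin d) :
    ContDiff ℝ ∞ (resolvent j : Rd3 d → ℂ) :=
  (contDiff_one_add_I_mul j).inv fun _ => one_add_I_mul_ne_zero _

theorem dirDeriv_resolvent {d : ℕ} (j : Fin d) (v : Rd3 d) :
    dirDeriv v (resolvent j) = (-(Complex.I * (v.2.2 j : ℝ))) • (resolvent j * resolvent j) := by
  have hg := contDiff_one_add_I_mul j
  -- Differentiate the identity `(1 + i ξ_j)⁻¹ (1 + i ξ_j) = 1` and solve for the derivative of the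
  -- first factor.
  have h1 := dirDeriv_mul v (contDiff_resolvent j) hg
  have h2 : resolvent j * (fun v : Rd3 d => 1 + Complex.I * ((v.2.2 j : ℝ) : ℂ)) = fun _ => 1 := by
    funext w
    exact inv_mul_cancel₀ (one_add_I_mul_ne_zero _)
  have h3 : dirDeriv v (fun w : Rd3 d => 1 + Complex.I * ((w.2.2 j : ℝ) : ℂ)) =
      fun _ => Complex.I * (v.2.2 j : ℝ) := by
    funext w
    have : HasFDerivAt (fun w : Rd3 d => 1 + Complex.I * ((w.2.2 j : ℝ) : ℂ))
        (Complex.I • (Complex.ofRealCLM.comp (xiCoord j))) w :=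
      (((Complex.ofRealCLM.comp (xiCoord j)).hasFDerivAt (x := w)).const_mul Complex.I).const_add 1
    rw [dirDeriv, this.fderiv]
    simp [xiCoord_apply]
  rw [h2, h3] at h1
  funext w
  have h4 := congrFun h1 w
  have h5 : dirDeriv v (fun _ : Rd3 d => (1 : ℂ)) w = 0 := by simp [dirDeriv]
  rw [h5] at h4
  simp only [Pi.add_apply, Pi.mul_apply] at h4
  simp only [Pi.smul_apply, Pi.mul_apply, smul_eq_mul]
  have h6 : (1 + Complex.I * ((w.2.2 j : ℝ) : ℂ)) * resolvent j w = 1 :=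
    mul_inv_cancel₀ (one_add_I_mul_ne_zero _)
  linear_combination (-resolvent j w) * h4 - (dirDeriv v (resolvent j) w) * h6

theorem dirDeriv_resolvent_pow {d : ℕ} (j : Fin d) (v : Rd3 d) (n : ℕ) :
    dirDeriv v (resolvent j ^ (n + 1)) =
      (-((n + 1) * (Complex.I * (v.2.2 j : ℝ)))) • resolvent j ^ (n + 2) := by
  induction n with
  | zero =>
    rw [zero_add, pow_one, dirDeriv_resolvent, zero_add, pow_two]
    simp
  | succ n ih =>
    rw [pow_succ, dirDeriv_mul v (show ContDiff ℝ ∞ (resolvent j ^ (n + 1)) from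
        (contDiff_resolvent j).pow (n + 1)) (contDiff_resolvent j), ih,
      dirDeriv_resolvent]
    funext w
    simp only [Pi.add_apply, Pi.mul_apply, Pi.smul_apply, Pi.pow_apply, smul_eq_mul]
    push_cast
    ring

theorem DerivBound.resolvent {d r : ℕ} (j : Fin d) :
    DerivBound r (fun n => (n.factorial : ℝ)) (fun v => ‖GevreyAP.resolvent j v‖)
      (GevreyAP.resolvent j : Rd3 d → ℂ) := by
  refine ⟨contDiff_resolvent j, fun l _ v => ?_⟩
  -- The induction needs all powers: a derivative of the power `n + 1` is at most `n + 1` times the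
  -- power `n + 2`, and the weight `n!` absorbs this coefficient. The claim is the case `n = 0`.
  have key : ∀ (l : List (Var d)) (n : ℕ), (n.factorial : ℝ) *
      ‖listDeriv (l.map dir) (GevreyAP.resolvent j ^ (n + 1)) v‖ ≤
        ((n + l.length).factorial : ℝ) * ‖GevreyAP.resolvent j v‖ := by
    intro l
    induction l with
    | nil =>
      intro n
      simp only [List.map_nil, listDeriv_nil, Pi.pow_apply, norm_pow, List.length_nil, add_zero]
      refine mul_le_mul_of_nonneg_left ?_ (by positivity)
      exact pow_le_of_le_one (norm_nonneg _) (norm_resolvent_le_one j v) (by omega)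
    | cons i l ih =>
      intro n
      rw [List.map_cons, listDeriv_cons, dirDeriv_resolvent_pow,
        listDeriv_smul _ _ (show ContDiff ℝ ∞ (GevreyAP.resolvent j ^ (n + 2)) from
          (contDiff_resolvent j).pow (n + 2)), Pi.smul_apply, norm_smul]
      have h1 : ‖-(((n : ℂ) + 1) * (Complex.I * (((dir i).2.2 j : ℝ) : ℂ)))‖ ≤ n + 1 := by
        have h2 : |(dir i).2.2 j| ≤ 1 := abs_xiCoord_dir_le j i
        have h3 : ‖(n : ℂ) + 1‖ = n + 1 := by exact_mod_cast Complex.norm_natCast (n + 1)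
        rw [norm_neg, norm_mul, norm_mul, Complex.norm_I, one_mul, Complex.norm_real,
          Real.norm_eq_abs, h3]
        exact mul_le_of_le_one_right (by positivity) h2
      calc (n.factorial : ℝ) * (‖-(((n : ℂ) + 1) * (Complex.I * (((dir i).2.2 j : ℝ) : ℂ)))‖ *
            ‖listDeriv (l.map dir) (GevreyAP.resolvent j ^ (n + 2)) v‖)
          ≤ (n.factorial : ℝ) * ((n + 1) *
            ‖listDeriv (l.map dir) (GevreyAP.resolvent j ^ (n + 2)) v‖) := by gcongr
        _ = ((n + 1).factorial : ℝ) *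
            ‖listDeriv (l.map dir) (GevreyAP.resolvent j ^ (n + 1 + 1)) v‖ := by
            rw [Nat.factorial_succ]; push_cast; ring
        _ ≤ _ := by
            refine (ih (n + 1)).trans (le_of_eq ?_)
            rw [List.length_cons, show n + 1 + l.length = n + (l.length + 1) by omega]
  simpa using key l 0

theorem norm_dir_le {d : ℕ} (i : Var d) : ‖dir i‖ ≤ 1 := by
  rcases i with j | j | j <;> simp [dir, xVec, yVec, xiVec, stdVec, Prod.norm_def]

/-- The sequence is the same for all `L` of norm at most two; this is the source of uniformity in
`ε`. No Gevrey growth is available, as `χ` is merely smooth. -/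
theorem exists_derivBound_comp {d : ℕ} {χ : Rd d → ℂ} (hχ : ContDiff ℝ ∞ χ)
    (hc : HasCompactSupport χ) :
    ∃ G : ℕ → ℝ, (∀ n, 0 ≤ G n) ∧ ∀ (r : ℕ) (L : Rd3 d →L[ℝ] Rd d), ‖L‖ ≤ 2 →
      DerivBound r G (fun _ => 1) (χ ∘ L) := by
  have hb : ∀ n : ℕ, ∃ A : ℝ, ∀ y, ‖iteratedFDeriv ℝ n χ y‖ ≤ A := by
    intro n
    have h1 : Continuous (iteratedFDeriv ℝ n χ) :=
      hχ.continuous_iteratedFDeriv (by exact_mod_cast le_top)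
    exact (hc.iteratedFDeriv (𝕜 := ℝ) n).exists_bound_of_continuous h1
  choose A hA using hb
  have hA0 : ∀ n, 0 ≤ A n := fun n => (norm_nonneg _).trans (hA n 0)
  refine ⟨fun n => A n * 2 ^ n, fun n => mul_nonneg (hA0 n) (by positivity), fun r L hL =>
    ⟨hχ.comp L.contDiff, fun l _ v => ?_⟩⟩
  have h1 := norm_listDeriv_le (l.map dir) (fun w hw => by
    obtain ⟨i, _, rfl⟩ := List.mem_map.1 hw
    exact norm_dir_le i) (hχ.comp L.contDiff) v
  refine h1.trans ?_
  rw [List.length_map, L.iteratedFDeriv_comp_right hχ v (by exact_mod_cast le_top), mul_one]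
  refine (ContinuousMultilinearMap.norm_compContinuousLinearMap_le _ _).trans ?_
  rw [Finset.prod_const, Finset.card_fin]
  exact mul_le_mul (hA _ _) (pow_le_pow_left₀ (norm_nonneg _) hL _) (by positivity) (hA0 _)

open MeasureTheory

/-! ### Integration by parts against `e^{2πi ξ·z}` -/

/-- The oscillating factor `e^{2πi ξ·z}`. -/
noncomputable def wave {d : ℕ} (p : Rd d × Rd d) : ℂ :=
  Complex.exp (2 * Real.pi * Complex.I * (inner ℝ p.2 p.1 : ℝ))

theorem norm_wave {d : ℕ} (p : Rd d × Rd d) : ‖wave p‖ = 1 := by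
  rw [wave, show (2 * Real.pi * Complex.I * ((inner ℝ p.2 p.1 : ℝ) : ℂ)) =
    ((2 * Real.pi * inner ℝ p.2 p.1 : ℝ) : ℂ) * Complex.I by push_cast; ring]
  exact Complex.norm_exp_ofReal_mul_I _

theorem contDiff_phase {d : ℕ} :
    ContDiff ℝ ∞ (fun p : Rd d × Rd d => 2 * Real.pi * Complex.I * ((inner ℝ p.2 p.1 : ℝ) : ℂ)) :=
  contDiff_const.mul (Complex.ofRealCLM.contDiff.comp (contDiff_snd.inner ℝ contDiff_fst))

theorem contDiff_wave {d : ℕ} : ContDiff ℝ ∞ (wave : Rd d × Rd d → ℂ) := contDiff_phase.cexp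

theorem dirDeriv_wave {d : ℕ} (e : Rd d × Rd d) :
    dirDeriv e wave = fun p : Rd d × Rd d =>
      (2 * Real.pi * Complex.I * ((inner ℝ p.2 e.1 + inner ℝ e.2 p.1 : ℝ) : ℂ)) * wave p := by
  funext p
  have h1 : HasFDerivAt (fun p : Rd d × Rd d => (inner ℝ p.2 p.1 : ℝ)) _ p :=
    (hasFDerivAt_snd (𝕜 := ℝ) (p := p)).inner ℝ (hasFDerivAt_fst (𝕜 := ℝ) (p := p))
  have h2 : HasFDerivAt (fun p : Rd d × Rd d => ((inner ℝ p.2 p.1 : ℝ) : ℂ)) _ p :=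
    Complex.ofRealCLM.hasFDerivAt.comp p h1
  have h3 := (h2.const_mul (2 * Real.pi * Complex.I)).cexp
  have h4 : dirDeriv e wave p = _ := congrArg (fun L => L e) h3.fderiv
  rw [h4]
  simp [wave]
  ring

theorem dirDeriv_slice {d : ℕ} {u : Rd3 d → ℂ} (hu : ContDiff ℝ ∞ u) (x : Rd d)
    (e : Rd d × Rd d) :
    (fun p => dirDeriv ((0, e) : Rd3 d) u (x, p)) = dirDeriv e (fun p => u (x, p)) := by
  funext p
  have h1 : HasFDerivAt u (fderiv ℝ u (x, p)) (x, p) :=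
    ((hu.differentiable (by simp)) (x, p)).hasFDerivAt
  have h2 := h1.comp p (hasFDerivAt_prodMk_right (𝕜 := ℝ) x p)
  have h3 : dirDeriv e (fun p => u (x, p)) p = _ := congrArg (fun L => L e) h2.fderiv
  rw [h3]
  simp [dirDeriv]

theorem contDiff_slice {d : ℕ} {u : Rd3 d → ℂ} (hu : ContDiff ℝ ∞ u) (x : Rd d) :
    ContDiff ℝ ∞ (fun p => u (x, p)) := hu.comp (contDiff_const.prodMk contDiff_id)

/-- Required to integrate by parts on the product space. -/
instance (d : ℕ) : (volume : Measure (Rd d × Rd d)).IsAddHaarMeasure :=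
  inferInstanceAs ((volume : Measure (Rd d)).prod (volume : Measure (Rd d))).IsAddHaarMeasure

section ByParts

variable {E : Type*} [NormedAddCommGroup E] [NormedSpace ℝ E]

theorem continuous_dirDeriv {f : E → ℂ} (hf : ContDiff ℝ ∞ f) (e : E) :
    Continuous (dirDeriv e f) := (contDiff_dirDeriv hf).continuous

theorem hasCompactSupport_dirDeriv {f : E → ℂ} (hf : HasCompactSupport f) (e : E) :
    HasCompactSupport (dirDeriv e f) := hf.fderiv_apply (𝕜 := ℝ) e

theorem hasCompactSupport_iterate_dirDeriv {f : E → ℂ} (hf : HasCompactSupport f) (e : E)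
    (n : ℕ) : HasCompactSupport ((dirDeriv e)^[n] f) := by
  induction n with
  | zero => exact hf
  | succ n ih => rw [Function.iterate_succ_apply']; exact hasCompactSupport_dirDeriv ih e

theorem integral_mul_dirDeriv [FiniteDimensional ℝ E] [MeasurableSpace E] [BorelSpace E]
    (μ : Measure E) [μ.IsAddHaarMeasure] {φ ψ : E → ℂ}
    (hφ : ContDiff ℝ ∞ φ) (hψ : ContDiff ℝ ∞ ψ) (hc : HasCompactSupport ψ) (e : E) :
    ∫ p, φ p * dirDeriv e ψ p ∂μ = -∫ p, dirDeriv e φ p * ψ p ∂μ := by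
  refine integral_mul_fderiv_eq_neg_fderiv_mul_of_integrable ?_ ?_ ?_
    (fun x _ => (hφ.differentiable (by simp)) x) (fun x _ => (hψ.differentiable (by simp)) x)
  · exact ((continuous_dirDeriv hφ e).mul hψ.continuous).integrable_of_hasCompactSupport
      hc.mul_left
  · exact (hφ.continuous.mul (continuous_dirDeriv hψ e)).integrable_of_hasCompactSupport
      (hasCompactSupport_dirDeriv hc e).mul_left
  · exact (hφ.continuous.mul hψ.continuous).integrable_of_hasCompactSupport hc.mul_left

end ByParts

/-- One integration by parts in the variable `z_j`, gaining a factor `(1 + i ξ_j)⁻¹`. -/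
noncomputable def reduceZ {d : ℕ} (j : Fin d) (u : Rd3 d → ℂ) : Rd3 d → ℂ :=
  resolvent j * u + (-(1 / (2 * Real.pi)) : ℂ) • dirDeriv (dir (.inr (.inl j))) (resolvent j * u)

theorem contDiff_resolvent_mul {d : ℕ} (j : Fin d) {u : Rd3 d → ℂ} (hu : ContDiff ℝ ∞ u) :
    ContDiff ℝ ∞ (resolvent j * u) := (contDiff_resolvent j).mul hu

theorem contDiff_reduceZ {d : ℕ} (j : Fin d) {u : Rd3 d → ℂ} (hu : ContDiff ℝ ∞ u) :
    ContDiff ℝ ∞ (reduceZ j u) :=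
  ContDiff.add (contDiff_resolvent_mul j hu)
    (ContDiff.const_smul (-(1 / (2 * Real.pi)) : ℂ)
      (contDiff_dirDeriv (v := dir (.inr (.inl j))) (contDiff_resolvent_mul j hu)))

theorem reduceZ_slice {d : ℕ} (j : Fin d) {u : Rd3 d → ℂ} (hu : ContDiff ℝ ∞ u) (x : Rd d)
    (p : Rd d × Rd d) : reduceZ j u (x, p) = resolvent j (x, p) * u (x, p) +
      (-(1 / (2 * Real.pi)) : ℂ) *
        dirDeriv (stdVec d j, 0) (fun p => resolvent j (x, p) * u (x, p)) p := by
  have h := congrFun (dirDeriv_slice (contDiff_resolvent_mul j hu) x (stdVec d j, 0)) p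
  simp only [Pi.mul_apply] at h
  rw [← h]
  rfl

theorem hasCompactSupport_reduceZ {d : ℕ} (j : Fin d) {u : Rd3 d → ℂ} (hu : ContDiff ℝ ∞ u)
    {x : Rd d} (hc : HasCompactSupport fun p => u (x, p)) :
    HasCompactSupport fun p => reduceZ j u (x, p) := by
  have h1 : HasCompactSupport fun p => resolvent j (x, p) * u (x, p) := hc.mul_left
  have h2 : HasCompactSupport fun p => (-(1 / (2 * Real.pi)) : ℂ) *
      dirDeriv (stdVec d j, 0) (fun p => resolvent j (x, p) * u (x, p)) p :=
    (hasCompactSupport_dirDeriv h1 _).mul_left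
  simp only [reduceZ_slice j hu]
  exact h1.add h2

/-- Moving `∂_{z_j}` back onto the exponential turns `1 - (2π)⁻¹ ∂_{z_j}` into the factor `1 + i
ξ_j`, which cancels the resolvent. -/
theorem integral_reduceZ {d : ℕ} (j : Fin d) {u : Rd3 d → ℂ} (hu : ContDiff ℝ ∞ u)
    {x : Rd d} (hc : HasCompactSupport fun p => u (x, p)) :
    ∫ p, wave p * reduceZ j u (x, p) = ∫ p, wave p * u (x, p) := by
  set ψ : Rd d × Rd d → ℂ := fun p => resolvent j (x, p) * u (x, p) with hψ
  have hcψ : HasCompactSupport ψ := hc.mul_left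
  have hsψ : ContDiff ℝ ∞ ψ := contDiff_slice (contDiff_resolvent_mul j hu) x
  have h1 := integral_mul_dirDeriv (volume : Measure (Rd d × Rd d)) contDiff_wave hsψ hcψ
    (stdVec d j, 0)
  have hi1 : Integrable fun p => wave p * ψ p :=
    (contDiff_wave.continuous.mul hsψ.continuous).integrable_of_hasCompactSupport hcψ.mul_left
  have hi2 : Integrable fun p => wave p * dirDeriv (stdVec d j, 0) ψ p :=
    (contDiff_wave.continuous.mul (continuous_dirDeriv hsψ _)).integrable_of_hasCompactSupport
      (hasCompactSupport_dirDeriv hcψ _).mul_left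
  have hi3 : Integrable fun p => dirDeriv (stdVec d j, 0) wave p * ψ p :=
    ((continuous_dirDeriv contDiff_wave _).mul hsψ.continuous).integrable_of_hasCompactSupport
      hcψ.mul_left
  have e1 : (fun p => wave p * reduceZ j u (x, p)) = fun p => wave p * ψ p +
      (-(1 / (2 * Real.pi)) : ℂ) * (wave p * dirDeriv (stdVec d j, 0) ψ p) := by
    funext p
    rw [reduceZ_slice j hu]
    ring
  rw [e1, integral_add hi1 (hi2.const_mul _), integral_const_mul, h1, mul_neg, ← neg_mul, neg_neg,
    ← integral_const_mul, ← integral_add hi1 (hi3.const_mul _)]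
  refine integral_congr_ae (Filter.Eventually.of_forall fun p => ?_)
  have hq : resolvent j ((x, p) : Rd3 d) * (1 + Complex.I * ((p.2 j : ℝ) : ℂ)) = 1 :=
    inv_mul_cancel₀ (one_add_I_mul_ne_zero _)
  have hin : (inner ℝ p.2 (stdVec d j) : ℝ) = p.2 j := by
    simp [stdVec, EuclideanSpace.inner_single_right]
  have hpi : (Real.pi : ℂ) ≠ 0 := by exact_mod_cast Real.pi_ne_zero
  simp only [dirDeriv_wave, hin, inner_zero_left, add_zero, hψ]
  have e2 : (1 / (2 * (Real.pi : ℂ))) * (2 * Real.pi) = 1 := by field_simp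
  linear_combination (wave p * u (x, p)) * hq +
    (Complex.I * ((p.2 j : ℝ) : ℂ) * wave p * resolvent j ((x, p) : Rd3 d) * u (x, p)) * e2

/-- Repeated integration by parts in the variables `z_j`. -/
noncomputable def reduceList {d : ℕ} (js : List (Fin d)) (u : Rd3 d → ℂ) : Rd3 d → ℂ :=
  js.foldl (fun g j => reduceZ j g) u

theorem reduceList_spec {d : ℕ} (js : List (Fin d)) {u : Rd3 d → ℂ} (hu : ContDiff ℝ ∞ u)
    {x : Rd d} (hc : HasCompactSupport fun p => u (x, p)) :
    HasCompactSupport (fun p => reduceList js u (x, p)) ∧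
      ∫ p, wave p * reduceList js u (x, p) = ∫ p, wave p * u (x, p) := by
  induction js generalizing u with
  | nil => exact ⟨hc, rfl⟩
  | cons j js ih =>
    obtain ⟨h1, h2⟩ := ih (contDiff_reduceZ j hu) (hasCompactSupport_reduceZ j hu hc)
    exact ⟨h1, h2.trans (integral_reduceZ j hu hc)⟩

theorem contDiff_reduceList {d : ℕ} (js : List (Fin d)) {u : Rd3 d → ℂ} (hu : ContDiff ℝ ∞ u) :
    ContDiff ℝ ∞ (reduceList js u) := by
  induction js generalizing u with
  | nil => exact hu
  | cons j js ih => exact ih (contDiff_reduceZ j hu)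

/-! ### Decay in `z` and the combined reduction -/

/-- The integration by parts in `ξ`. -/
noncomputable def reduceXi {d : ℕ} (M : ℕ) (u : Rd3 d → ℂ) : Rd3 d → ℂ :=
  u + ((-1) ^ M : ℂ) • ∑ j, (dirDeriv (dir (.inr (.inr j))))^[2 * M] u

/-- The weight `1 + ∑ (2π z_j)^{2M}`. -/
noncomputable def zWeight {d : ℕ} (M : ℕ) (z : Rd d) : ℝ := 1 + ∑ j, (2 * Real.pi * z j) ^ (2 * M)

theorem one_le_zWeight {d : ℕ} (M : ℕ) (z : Rd d) : 1 ≤ zWeight M z := by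
  unfold zWeight
  have : 0 ≤ ∑ j, (2 * Real.pi * z j) ^ (2 * M) :=
    Finset.sum_nonneg fun j _ => (even_two_mul M).pow_nonneg _
  linarith

theorem contDiff_coord {d : ℕ} (j : Fin d) : ContDiff ℝ ∞ (fun z : Rd d => z j) :=
  (EuclideanSpace.proj j : Rd d →L[ℝ] ℝ).contDiff

theorem contDiff_zWeight {d : ℕ} (M : ℕ) : ContDiff ℝ ∞ (zWeight M : Rd d → ℝ) :=
  contDiff_const.add (ContDiff.sum fun j _ => (contDiff_const.mul (contDiff_coord j)).pow _)

/-- The absolutely integrable kernel `(1 + ∑ (2π z_j)^{2M})⁻¹ e^{2πi ξ·z}`. -/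
noncomputable def kernel {d : ℕ} (M : ℕ) (p : Rd d × Rd d) : ℂ :=
  (((zWeight M p.1)⁻¹ : ℝ) : ℂ) * wave p

theorem contDiff_inv_zWeight {d : ℕ} (M : ℕ) :
    ContDiff ℝ ∞ (fun z : Rd d => (((zWeight M z)⁻¹ : ℝ) : ℂ)) :=
  Complex.ofRealCLM.contDiff.comp
    ((contDiff_zWeight M).inv fun z => (zero_lt_one.trans_le (one_le_zWeight M z)).ne')

theorem iterate_dirDeriv_slice {d : ℕ} {u : Rd3 d → ℂ} (hu : ContDiff ℝ ∞ u) (x : Rd d)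
    (e : Rd d × Rd d) (n : ℕ) :
    (fun p => ((dirDeriv ((0, e) : Rd3 d))^[n] u) (x, p)) =
      (dirDeriv e)^[n] (fun p => u (x, p)) := by
  induction n with
  | zero => rfl
  | succ n ih =>
    simp only [Function.iterate_succ_apply']
    rw [dirDeriv_slice (contDiff_iterate_dirDeriv n hu) x e, ih]

/-- A function of `z` is inert under `∂_{ξ_j}`, so every integration by parts just multiplies it by
`-2πi z_j`. Keeping `g` general lets the induction absorb these factors. -/
theorem integral_iterate_xi {d : ℕ} (j : Fin d) (n : ℕ) {g : Rd d → ℂ} (hg : ContDiff ℝ ∞ g)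
    {ψ : Rd d × Rd d → ℂ} (hψ : ContDiff ℝ ∞ ψ) (hc : HasCompactSupport ψ) :
    ∫ p, (g p.1 * wave p) * (dirDeriv (0, stdVec d j))^[n] ψ p =
      ∫ p, (g p.1 * (-(2 * Real.pi * Complex.I * ((p.1 j : ℝ) : ℂ))) ^ n * wave p) * ψ p := by
  induction n generalizing g with
  | zero => simp
  | succ n ih =>
    have hg1 : ContDiff ℝ ∞ (fun p : Rd d × Rd d => g p.1) := hg.comp contDiff_fst
    have hφ : ContDiff ℝ ∞ (fun p : Rd d × Rd d => g p.1 * wave p) := hg1.mul contDiff_wave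
    simp only [Function.iterate_succ_apply']
    rw [integral_mul_dirDeriv volume hφ (contDiff_iterate_dirDeriv n hψ)
      (hasCompactSupport_iterate_dirDeriv hc _ n), ← integral_neg]
    have hd : dirDeriv ((0, stdVec d j) : Rd d × Rd d) (fun p => g p.1 * wave p) =
        fun p => g p.1 * (2 * Real.pi * Complex.I * ((p.1 j : ℝ) : ℂ)) * wave p := by
      have h1 := dirDeriv_mul ((0, stdVec d j) : Rd d × Rd d) hg1 contDiff_wave
      have h2 : dirDeriv ((0, stdVec d j) : Rd d × Rd d) (fun p => g p.1) = 0 := by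
        have := dirDeriv_comp_clm (ContinuousLinearMap.fst ℝ (Rd d) (Rd d)) (0, stdVec d j) hg
        rw [ContinuousLinearMap.coe_fst', dirDeriv_zero_dir] at this
        exact this
      rw [h2, zero_mul, zero_add, dirDeriv_wave] at h1
      refine h1.trans (funext fun p => ?_)
      have hin : (inner ℝ (stdVec d j) p.1 : ℝ) = p.1 j := by
        simp [stdVec, EuclideanSpace.inner_single_left]
      simp only [Pi.mul_apply, inner_zero_right, zero_add, hin]
      ring
    rw [hd]
    have h3 := ih (g := fun z => g z * (-(2 * Real.pi * Complex.I * ((z j : ℝ) : ℂ))))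
      (hg.mul (contDiff_const.mul (Complex.ofRealCLM.contDiff.comp (contDiff_coord j))).neg)
    refine (Eq.trans ?_ h3).trans ?_
    · refine integral_congr_ae (Filter.Eventually.of_forall fun p => ?_)
      simp only []
      ring
    · refine integral_congr_ae (Filter.Eventually.of_forall fun p => ?_)
      simp only [pow_succ]
      ring

theorem integral_reduceXi {d : ℕ} (M : ℕ) {u : Rd3 d → ℂ} (hu : ContDiff ℝ ∞ u)
    {x : Rd d} (hc : HasCompactSupport fun p => u (x, p)) :
    ∫ p, kernel M p * reduceXi M u (x, p) = ∫ p, wave p * u (x, p) := by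
  set ψ : Rd d × Rd d → ℂ := fun p => u (x, p) with hψ
  have hsψ : ContDiff ℝ ∞ ψ := contDiff_slice hu x
  have hker : Continuous (kernel M : Rd d × Rd d → ℂ) :=
    ((contDiff_inv_zWeight M).continuous.comp continuous_fst).mul contDiff_wave.continuous
  have e1 : ∀ p, reduceXi M u (x, p) =
      ψ p + (-1) ^ M * ∑ j, (dirDeriv (0, stdVec d j))^[2 * M] ψ p := by
    intro p
    simp only [reduceXi, Pi.add_apply, Pi.smul_apply, smul_eq_mul, Finset.sum_apply]
    congr 2
    refine Finset.sum_congr rfl fun j _ => ?_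
    exact congrFun (iterate_dirDeriv_slice hu x (0, stdVec d j) (2 * M)) p
  have hi0 : Integrable fun p => kernel M p * ψ p :=
    (hker.mul hsψ.continuous).integrable_of_hasCompactSupport hc.mul_left
  have hi : ∀ j, Integrable fun p => kernel M p * (dirDeriv (0, stdVec d j))^[2 * M] ψ p :=
    fun j => (hker.mul (contDiff_iterate_dirDeriv _ hsψ).continuous).integrable_of_hasCompactSupport
      (hasCompactSupport_iterate_dirDeriv hc _ _).mul_left
  have hk : Continuous fun p : Rd d × Rd d => fun j : Fin d =>
      (-(2 * Real.pi * Complex.I * ((p.1 j : ℝ) : ℂ))) := by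
    refine continuous_pi fun j => (continuous_const.mul ?_).neg
    exact Complex.continuous_ofReal.comp ((contDiff_coord j).continuous.comp continuous_fst)
  have hi' : ∀ j, Integrable fun p : Rd d × Rd d => ((((zWeight M p.1)⁻¹ : ℝ) : ℂ) *
      (-(2 * Real.pi * Complex.I * ((p.1 j : ℝ) : ℂ))) ^ (2 * M) * wave p) * ψ p := fun j =>
    (((((contDiff_inv_zWeight M).continuous.comp continuous_fst).mul
      (((continuous_apply j).comp hk).pow _)).mul contDiff_wave.continuous).mul
      hsψ.continuous).integrable_of_hasCompactSupport hc.mul_left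
  calc ∫ p, kernel M p * reduceXi M u (x, p)
      = ∫ p, (kernel M p * ψ p +
          (-1) ^ M * ∑ j, kernel M p * (dirDeriv (0, stdVec d j))^[2 * M] ψ p) := by
        refine integral_congr_ae (Filter.Eventually.of_forall fun p => ?_)
        simp only [e1, ← Finset.mul_sum]
        ring
    _ = (∫ p, kernel M p * ψ p) + (-1) ^ M * ∑ j, ∫ p,
          kernel M p * (dirDeriv (0, stdVec d j))^[2 * M] ψ p := by
        rw [integral_add hi0 ((integrable_finsetSum _ fun j _ => hi j).const_mul _),
          integral_const_mul, integral_finsetSum _ fun j _ => hi j]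
    _ = (∫ p, kernel M p * ψ p) + (-1) ^ M * ∑ j, ∫ p, ((((zWeight M p.1)⁻¹ : ℝ) : ℂ) *
          (-(2 * Real.pi * Complex.I * ((p.1 j : ℝ) : ℂ))) ^ (2 * M) * wave p) * ψ p := by
        congr 2
        exact Finset.sum_congr rfl fun j _ =>
          integral_iterate_xi j (2 * M) (contDiff_inv_zWeight M) hsψ hc
    _ = ∫ p, (kernel M p * ψ p + (-1) ^ M * ∑ j, ((((zWeight M p.1)⁻¹ : ℝ) : ℂ) *
          (-(2 * Real.pi * Complex.I * ((p.1 j : ℝ) : ℂ))) ^ (2 * M) * wave p) * ψ p) := by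
        rw [integral_add hi0 ((integrable_finsetSum _ fun j _ => hi' j).const_mul _),
          integral_const_mul, integral_finsetSum _ fun j _ => hi' j]
    _ = ∫ p, wave p * ψ p := by
        refine integral_congr_ae (Filter.Eventually.of_forall fun p => ?_)
        simp only [kernel]
        rw [← Finset.sum_mul, ← Finset.sum_mul, ← Finset.mul_sum]
        have hw : (zWeight M p.1 : ℂ) ≠ 0 := by
          exact_mod_cast (zero_lt_one.trans_le (one_le_zWeight M p.1)).ne'
        -- The sign `(-1)^M` compensates `i^{2M}`, so the terms add up to the nonnegative part of
        -- the weight.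
        have hs : (-1 : ℂ) ^ M * ∑ j, (-(2 * Real.pi * Complex.I * ((p.1 j : ℝ) : ℂ))) ^ (2 * M) =
            (zWeight M p.1 : ℂ) - 1 := by
          simp only [zWeight]
          push_cast
          rw [add_sub_cancel_left, Finset.mul_sum]
          refine Finset.sum_congr rfl fun j _ => ?_
          rw [(even_two_mul M).neg_pow, show 2 * (Real.pi : ℂ) * Complex.I * ((p.1 j : ℝ) : ℂ) =
            Complex.I * (2 * Real.pi * ((p.1 j : ℝ) : ℂ)) by ring, mul_pow, pow_mul Complex.I,
            Complex.I_sq, ← mul_assoc, ← mul_pow]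
          simp
        have hinv : (((zWeight M p.1)⁻¹ : ℝ) : ℂ) * (zWeight M p.1 : ℂ) = 1 := by
          push_cast; exact inv_mul_cancel₀ hw
        linear_combination (((zWeight M p.1)⁻¹ : ℝ) : ℂ) * wave p * ψ p * hs + wave p * ψ p * hinv
/-- The total integration by parts: `m₀ + d + 1` times in each `z_j`, then once in `ξ`. -/
noncomputable def reduce {d : ℕ} (M m₀ : ℕ) (u : Rd3 d → ℂ) : Rd3 d → ℂ :=
  reduceXi M (reduceList (multiList id fun _ => m₀ + d + 1) u)

theorem integral_reduce {d : ℕ} (M m₀ : ℕ) {u : Rd3 d → ℂ} (hu : ContDiff ℝ ∞ u)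
    {x : Rd d} (hc : HasCompactSupport fun p => u (x, p)) :
    ∫ p, kernel M p * reduce M m₀ u (x, p) = ∫ p, wave p * u (x, p) := by
  obtain ⟨h1, h2⟩ := reduceList_spec (multiList id fun _ => m₀ + d + 1) hu hc
  rw [← h2]
  exact integral_reduceXi M (contDiff_reduceList _ hu) h1

/-! Locality -/

theorem reduceZ_congr {d : ℕ} (j : Fin d) {u u' : Rd3 d → ℂ} {v : Rd3 d} (h : u =ᶠ[𝓝 v] u') :
    reduceZ j u =ᶠ[𝓝 v] reduceZ j u' := by
  have h1 : resolvent j * u =ᶠ[𝓝 v] resolvent j * u' := Filter.EventuallyEq.rfl.mul h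
  exact h1.add ((dirDeriv_congr _ h1).const_smul _)

theorem reduceList_congr {d : ℕ} (js : List (Fin d)) {u u' : Rd3 d → ℂ} {v : Rd3 d}
    (h : u =ᶠ[𝓝 v] u') : reduceList js u =ᶠ[𝓝 v] reduceList js u' := by
  induction js generalizing u u' with
  | nil => exact h
  | cons j js ih => exact ih (reduceZ_congr j h)

/-- The reduction is a differential operator, hence local; this confines the effect of a cutoff to
the region where it differs from one. -/
theorem reduce_congr {d : ℕ} (M m₀ : ℕ) {u u' : Rd3 d → ℂ} {v : Rd3 d} (h : u =ᶠ[𝓝 v] u') :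
    reduce M m₀ u v = reduce M m₀ u' v := by
  have h1 := reduceList_congr (multiList id fun _ => m₀ + d + 1) h
  have h2 : ∀ j : Fin d, _ := fun j =>
    (iterate_dirDeriv_congr (dir (.inr (.inr j))) (2 * M) h1).eq_of_nhds
  simp only [reduce, reduceXi, Pi.add_apply, Pi.smul_apply, Finset.sum_apply, h1.eq_of_nhds, h2]

/-! Bounds -/

/-- The decaying weight `⟨ξ⟩^{-(d+1)}`. -/
noncomputable def decay {d : ℕ} (ξ : Rd d) : ℝ := (japanese ξ ^ (d + 1))⁻¹

theorem decay_nonneg {d : ℕ} (ξ : Rd d) : 0 ≤ decay ξ :=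
  inv_nonneg.2 (pow_nonneg (zero_le_one.trans (one_le_japanese ξ)) _)

/-- The new sequence depends on `G` alone, which gives uniformity in `u`. The Gevrey property is
only an implication, so that the bound also serves functions carrying a smooth, non-Gevrey cutoff.
-/
theorem exists_reduceZ_bound {d r : ℕ} (s : ℝ) (hs : 1 ≤ s) {G : ℕ → ℝ} (hG : ∀ n, 0 ≤ G n) :
    ∃ G' : ℕ → ℝ, (∀ n, 0 ≤ G' n) ∧ (IsGevSeq s G → IsGevSeq s G') ∧
      ∀ (j : Fin d) (W : Rd3 d → ℝ) (u : Rd3 d → ℂ), DerivBound r G W u →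
        DerivBound r G' (fun v => ‖resolvent j v‖ * W v) (reduceZ j u) := by
  have hs0 : 0 ≤ s := by linarith
  have h0 : ∀ n, 0 ≤ binConv (fun n => (n.factorial : ℝ)) G n :=
    binConv_nonneg (fun n => by positivity) hG
  refine ⟨fun n => binConv (fun n => (n.factorial : ℝ)) G n + ‖(-(1 / (2 * Real.pi)) : ℂ)‖ *
    shift (binConv (fun n => (n.factorial : ℝ)) G) n, fun n => add_nonneg (h0 n)
      (mul_nonneg (norm_nonneg _) (h0 _)), fun h => ?_, fun j W u h => ?_⟩
  · have h1 := (isGevSeq_factorial hs).binConv hs0 h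
    exact h1.add_const_mul (norm_nonneg _) (h1.shift hs0)
  · have h1 := (DerivBound.resolvent (r := r) j).mul h
    exact h1.add_smul _ (h1.dirDeriv (.inr (.inl j)) (by simp [isXi]))

theorem exists_reduceList_bound {d r : ℕ} (s : ℝ) (hs : 1 ≤ s) (js : List (Fin d)) {G : ℕ → ℝ}
    (hG : ∀ n, 0 ≤ G n) :
    ∃ G' : ℕ → ℝ, (∀ n, 0 ≤ G' n) ∧ (IsGevSeq s G → IsGevSeq s G') ∧
      ∀ (W : Rd3 d → ℝ) (u : Rd3 d → ℂ), DerivBound r G W u →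
        DerivBound r G' (fun v => (js.map fun j => ‖resolvent j v‖).prod * W v)
          (reduceList js u) := by
  induction js generalizing G with
  | nil => exact ⟨G, hG, id, fun W u h => by simpa [reduceList] using h⟩
  | cons j js ih =>
    obtain ⟨G₁, h0, h1, h2⟩ := exists_reduceZ_bound (d := d) (r := r) s hs hG
    obtain ⟨G₂, h0', h1', h2'⟩ := ih h0
    refine ⟨G₂, h0', h1' ∘ h1, fun W u h => ?_⟩
    have := h2' _ _ (h2 j W u h)
    have e : (fun v : Rd3 d => ((j :: js).map fun j => ‖resolvent j v‖).prod * W v) =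
        fun v => (js.map fun j => ‖resolvent j v‖).prod * (‖resolvent j v‖ * W v) := by
      funext v; rw [List.map_cons, List.prod_cons]; ring
    rw [e]
    exact this

/-- Expanding the product gives `∏ (1 + ξ_j²) ≥ 1 + |ξ|²`. -/
theorem prod_resolvent_le {d : ℕ} (K : ℕ) (v : Rd3 d) :
    ((multiList id fun _ : Fin d => K).map fun j => ‖resolvent j v‖).prod ≤
      (japanese v.2.2 ^ K)⁻¹ := by
  have h1 : ((multiList id fun _ : Fin d => K).map fun j => ‖resolvent j v‖).prod =
      (∏ j, ‖resolvent j v‖) ^ K := by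
    rw [map_multiList, ← Finset.prod_pow, Fin.prod_univ_def]
    simp only [multiList]
    induction List.finRange d with
    | nil => simp
    | cons j l ih =>
      rw [List.flatMap_cons, List.prod_append, ih, List.map_cons, List.prod_cons,
        List.prod_replicate]
      rfl
  have h2 : ∏ j, ‖resolvent j v‖ ≤ (japanese v.2.2)⁻¹ := by
    simp only [norm_resolvent, Finset.prod_inv_distrib]
    refine inv_anti₀ (by linarith [one_le_japanese v.2.2]) ?_
    rw [japanese, EuclideanSpace.norm_sq_eq, ← Real.sqrt_prod _ fun j _ => by positivity]
    refine Real.sqrt_le_sqrt ?_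
    simp only [Real.norm_eq_abs, sq_abs]
    have : ∀ S : Finset (Fin d), 1 + ∑ j ∈ S, v.2.2 j ^ 2 ≤ ∏ j ∈ S, (1 + v.2.2 j ^ 2) := by
      intro S
      induction S using Finset.induction_on with
      | empty => simp
      | insert i S hi ih =>
        rw [Finset.sum_insert hi, Finset.prod_insert hi]
        have h3 : 0 ≤ ∑ j ∈ S, v.2.2 j ^ 2 := Finset.sum_nonneg fun _ _ => sq_nonneg _
        nlinarith [sq_nonneg (v.2.2 i)]
    exact this Finset.univ
  rw [h1, ← inv_pow]
  exact pow_le_pow_left₀ (Finset.prod_nonneg fun _ _ => norm_nonneg _) h2 K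

/-- The resolvents trade `⟨ξ⟩^{m₀}` for `⟨ξ⟩^{-(d+1)}`. The last step spends all `2M` available
derivatives in `ξ`, whence the order `0` of the result; derivatives in `x` remain unrestricted. -/
theorem exists_reduce_bound {d : ℕ} (M m₀ : ℕ) (s : ℝ) (hs : 1 ≤ s) {G : ℕ → ℝ}
    (hG : ∀ n, 0 ≤ G n) :
    ∃ G' : ℕ → ℝ, (∀ n, 0 ≤ G' n) ∧ (IsGevSeq s G → IsGevSeq s G') ∧
      ∀ (t : ℝ) (u : Rd3 d → ℂ), 0 ≤ t →
        DerivBound (2 * M) G (fun v => t * japanese v.2.2 ^ m₀) u →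
        DerivBound 0 G' (fun v => t * decay v.2.2) (reduce M m₀ u) := by
  have hs0 : 0 ≤ s := by linarith
  obtain ⟨G₁, h0, h1, h2⟩ := exists_reduceList_bound (d := d) (r := 2 * M) s hs
    (multiList id fun _ => m₀ + d + 1) hG
  have h0' : ∀ n, 0 ≤ (shift^[2 * M] G₁) n := by
    have : ∀ (k n : ℕ), 0 ≤ (shift^[k] G₁) n := by
      intro k
      induction k with
      | zero => exact h0
      | succ k ih => intro n; rw [Function.iterate_succ_apply']; exact ih _
    exact this _
  refine ⟨fun n => G₁ n + d * (shift^[2 * M] G₁) n,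
    fun n => add_nonneg (h0 n) (mul_nonneg (Nat.cast_nonneg _) (h0' n)),
    fun h => (h1 h).add_const_mul (Nat.cast_nonneg _) ((h1 h).iterate_shift hs0 _),
    fun t u ht h => ?_⟩
  have hw : ∀ v : Rd3 d, 0 ≤ t * decay v.2.2 := fun v => mul_nonneg ht (decay_nonneg _)
  have h3 : DerivBound (2 * M) G₁ (fun v => t * decay v.2.2)
      (reduceList (multiList id fun _ => m₀ + d + 1) u) := by
    refine (h2 _ u h).mono_weight h0 fun v => ?_
    have hj := one_le_japanese v.2.2
    have hj0 : 0 < japanese v.2.2 := by linarith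
    calc ((multiList id fun _ : Fin d => m₀ + d + 1).map fun j => ‖resolvent j v‖).prod *
          (t * japanese v.2.2 ^ m₀)
        ≤ (japanese v.2.2 ^ (m₀ + d + 1))⁻¹ * (t * japanese v.2.2 ^ m₀) :=
          mul_le_mul_of_nonneg_right (prod_resolvent_le _ v) (by positivity)
      _ = t * decay v.2.2 := by
          rw [decay, add_assoc, pow_add]
          field_simp
  have h4 := DerivBound.sum Finset.univ hw (fun j : Fin d =>
    h3.iterate_dirDeriv (r' := 0) (.inr (.inr j)) (2 * M) (by omega))
  have h5 := (h3.of_le (Nat.zero_le _)).add_smul ((-1) ^ M) h4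
  refine h5.mono hw fun n => ?_
  simp

/-! Integrability -/

theorem integrable_decay {d : ℕ} : Integrable (decay : Rd d → ℝ) := by
  have h := integrable_rpow_neg_one_add_norm_sq (E := Rd d) (μ := volume) (r := (d + 1 : ℝ))
    (by simp)
  refine h.congr (Filter.Eventually.of_forall fun ξ => ?_)
  simp only [decay, japanese]
  rw [Real.sqrt_eq_rpow, ← Real.rpow_natCast _ (d + 1), ← Real.rpow_mul (by positivity),
    ← Real.rpow_neg (by positivity)]
  congr 1
  push_cast
  ring

theorem continuous_zWeight {d : ℕ} (M : ℕ) : Continuous (zWeight M : Rd d → ℝ) :=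
  (contDiff_zWeight M).continuous

theorem norm_le_sum_abs {d : ℕ} (z : Rd d) : ‖z‖ ≤ ∑ j, |z j| := by
  have h : ‖z‖ ^ 2 ≤ (∑ j, |z j|) ^ 2 := by
    rw [EuclideanSpace.norm_sq_eq]
    simp only [Real.norm_eq_abs]
    exact Finset.sum_sq_le_sq_sum_of_nonneg fun j _ => abs_nonneg _
  exact le_of_sq_le_sq h (Finset.sum_nonneg fun j _ => abs_nonneg _)

/-- The weight dominates a multiple of `(1 + |z|)^{2M}`, and `2M > d`. -/
theorem integrable_inv_zWeight {d M : ℕ} (hM : d < 2 * M) :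
    Integrable (fun z : Rd d => (zWeight M z)⁻¹) := by
  have h := integrable_one_add_norm (E := Rd d) (μ := volume) (r := ((2 * M : ℕ) : ℝ))
    (by simpa using (by exact_mod_cast hM : (d : ℝ) < ((2 * M : ℕ) : ℝ)))
  -- Convexity inequalities for the power `n + 1` carry constants with exponent `n`: `2ⁿ` from
  -- splitting `1 + |z|`, and `dⁿ ≤ (1 + d)ⁿ` from splitting `∑ |z_j|`.
  obtain ⟨n, hn⟩ : ∃ n, 2 * M = n + 1 := ⟨2 * M - 1, by omega⟩
  refine (h.const_mul (2 ^ n * (1 + d) ^ n)).mono' ?_ (Filter.Eventually.of_forall fun z => ?_)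
  · exact ((continuous_zWeight M).inv₀ fun z =>
      (zero_lt_one.trans_le (one_le_zWeight M z)).ne').aestronglyMeasurable
  have hw := one_le_zWeight M z
  have hw0 : 0 < zWeight M z := by linarith
  rw [Real.norm_eq_abs, abs_of_pos (inv_pos.2 hw0), Real.rpow_neg (by positivity),
    Real.rpow_natCast, ← div_eq_mul_inv, inv_le_iff_one_le_mul₀ hw0, div_mul_eq_mul_div,
    one_le_div (by positivity), hn]
  have h1 : (1 + ‖z‖) ^ (n + 1) ≤ 2 ^ n * (1 ^ (n + 1) + ‖z‖ ^ (n + 1)) := by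
    simpa using add_pow_le zero_le_one (norm_nonneg z) (n + 1)
  have h2 : ‖z‖ ^ (n + 1) ≤ (1 + d) ^ n * ∑ j, |z j| ^ (n + 1) := by
    have h3 := pow_sum_div_card_le_sum_pow (s := Finset.univ) (f := fun j => |z j|)
      (fun j _ => abs_nonneg _) n
    rw [Finset.card_univ, Fintype.card_fin] at h3
    refine (pow_le_pow_left₀ (norm_nonneg z) (norm_le_sum_abs z) _).trans ?_
    rcases Nat.eq_zero_or_pos d with rfl | hd
    · simp
    · rw [div_le_iff₀ (by positivity), mul_comm] at h3
      refine h3.trans (mul_le_mul_of_nonneg_right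
        (pow_le_pow_left₀ (by positivity) (by linarith) _) (by positivity))
  have h4 : ∑ j, |z j| ^ (n + 1) ≤ zWeight M z - 1 := by
    simp only [zWeight, add_sub_cancel_left, hn]
    refine Finset.sum_le_sum fun j _ => ?_
    rw [← hn, (even_two_mul M).pow_abs]
    rw [mul_pow]
    refine le_mul_of_one_le_left ((even_two_mul M).pow_nonneg _) (one_le_pow₀ ?_)
    linarith [Real.pi_gt_three]
  have h5 : (1 : ℝ) ≤ (1 + d) ^ n := one_le_pow₀ (by linarith [Nat.cast_nonneg (α := ℝ) d])
  calc (1 + ‖z‖) ^ (n + 1) ≤ 2 ^ n * (1 ^ (n + 1) + ‖z‖ ^ (n + 1)) := h1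
    _ ≤ 2 ^ n * ((1 + d) ^ n * 1 + (1 + d) ^ n * (zWeight M z - 1)) := by
        refine mul_le_mul_of_nonneg_left (add_le_add (by simpa using h5)
          (h2.trans (mul_le_mul_of_nonneg_left h4 (by positivity)))) (by positivity)
    _ = _ := by ring

theorem continuous_kernel {d : ℕ} (M : ℕ) : Continuous (kernel M : Rd d × Rd d → ℂ) :=
  ((contDiff_inv_zWeight M).continuous.comp continuous_fst).mul contDiff_wave.continuous

theorem norm_kernel {d : ℕ} (M : ℕ) (p : Rd d × Rd d) : ‖kernel M p‖ = (zWeight M p.1)⁻¹ := by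
  rw [kernel, norm_mul, norm_wave, mul_one, Complex.norm_real, Real.norm_eq_abs, abs_of_pos]
  exact inv_pos.2 (zero_lt_one.trans_le (one_le_zWeight M p.1))

theorem integrable_kernel_decay {d M : ℕ} (hM : d < 2 * M) :
    Integrable (fun p : Rd d × Rd d => ‖kernel M p‖ * decay p.2) := by
  simp only [norm_kernel]
  exact (integrable_inv_zWeight hM).mul_prod integrable_decay
/-! ### Smoothness of the absolutely convergent integral -/

/-- The absolutely convergent integral against the kernel. -/
noncomputable def kernelIntegral {d : ℕ} (M : ℕ) (u : Rd3 d → ℂ) (x : Rd d) : ℂ :=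
  ∫ p, kernel M p * u (x, p)

theorem sum_coord_smul_stdVec {d : ℕ} (y : Rd d) : ∑ j, y j • stdVec d j = y := by
  have := (EuclideanSpace.basisFun (Fin d) ℝ).sum_repr y
  simpa [stdVec] using this

theorem clm_apply_eq_sum {d : ℕ} (L : Rd d →L[ℝ] ℂ) (y : Rd d) :
    L y = ∑ j, (y j : ℂ) * L (stdVec d j) := by
  conv_lhs => rw [← sum_coord_smul_stdVec y]
  simp

theorem abs_coord_le {d : ℕ} (y : Rd d) (j : Fin d) : |y j| ≤ ‖y‖ := by
  simpa using PiLp.norm_apply_le y j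

theorem norm_clm_le_sum {d : ℕ} (L : Rd d →L[ℝ] ℂ) : ‖L‖ ≤ ∑ j, ‖L (stdVec d j)‖ := by
  refine L.opNorm_le_bound (Finset.sum_nonneg fun _ _ => norm_nonneg _) fun y => ?_
  rw [clm_apply_eq_sum L y, Finset.sum_mul]
  refine (norm_sum_le _ _).trans (Finset.sum_le_sum fun j _ => ?_)
  rw [norm_mul, Complex.norm_real, Real.norm_eq_abs, mul_comm]
  exact mul_le_mul_of_nonneg_left (abs_coord_le y j) (norm_nonneg _)

section Smooth

variable {d M : ℕ} {G : ℕ → ℝ} {t : ℝ} {u : Rd3 d → ℂ}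

theorem DerivBound.norm_kernel_mul_le (h : DerivBound 0 G (fun v => t * decay v.2.2) u)
    (x : Rd d) (p : Rd d × Rd d) :
    ‖kernel M p * u (x, p)‖ ≤ G 0 * t * (‖kernel M p‖ * decay p.2) := by
  rw [norm_mul]
  calc ‖kernel M p‖ * ‖u (x, p)‖ ≤ ‖kernel M p‖ * (G 0 * (t * decay p.2)) :=
        mul_le_mul_of_nonneg_left (h.norm_le (x, p)) (norm_nonneg _)
    _ = _ := by ring

theorem DerivBound.integrable_kernel_mul (hM : d < 2 * M)
    (h : DerivBound 0 G (fun v => t * decay v.2.2) u) (x : Rd d) :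
    Integrable fun p => kernel M p * u (x, p) :=
  ((integrable_kernel_decay hM).const_mul (G 0 * t)).mono'
    ((continuous_kernel M).mul (contDiff_slice h.contDiff x).continuous).aestronglyMeasurable
    (Filter.Eventually.of_forall fun p => h.norm_kernel_mul_le x p)

theorem DerivBound.norm_kernelIntegral_le (hM : d < 2 * M)
    (h : DerivBound 0 G (fun v => t * decay v.2.2) u) (x : Rd d) :
    ‖kernelIntegral M u x‖ ≤ G 0 * t * ∫ p : Rd d × Rd d, ‖kernel M p‖ * decay p.2 := by
  rw [← integral_const_mul]
  exact norm_integral_le_of_norm_le ((integrable_kernel_decay hM).const_mul (G 0 * t))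
    (Filter.Eventually.of_forall fun p => h.norm_kernel_mul_le x p)

/-- Differentiation under the integral sign: the first `x` derivatives have the same integrable
majorant up to a constant, uniformly in `x`. -/
theorem DerivBound.hasFDerivAt_kernelIntegral (hM : d < 2 * M)
    (h : DerivBound 0 G (fun v => t * decay v.2.2) u) :
    Differentiable ℝ (kernelIntegral M u) ∧ ∀ x y, fderiv ℝ (kernelIntegral M u) x y =
      ∑ j, (y j : ℂ) * kernelIntegral M (GevreyAP.dirDeriv (dir (.inl j)) u) x := by
  set F' : Rd d → Rd d × Rd d → Rd d →L[ℝ] ℂ := fun x p =>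
    kernel M p • (fderiv ℝ u (x, p)).comp (ContinuousLinearMap.inl ℝ (Rd d) (Rd d × Rd d)) with hF'
  have hF'_apply : ∀ x p j, F' x p (stdVec d j) =
      kernel M p * GevreyAP.dirDeriv (dir (.inl j)) u (x, p) := fun x p j => rfl
  have hd : ∀ j : Fin d, DerivBound 0 (shift G) (fun v => t * decay v.2.2)
      (GevreyAP.dirDeriv (dir (.inl j)) u) := fun j => h.dirDeriv (.inl j) (by simp [isXi])
  have hcont : ∀ x, Continuous (F' x) := by
    intro x
    have h1 : Continuous (fderiv ℝ u) := h.contDiff.continuous_fderiv (by simp)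
    have h2 : Continuous fun p : Rd d × Rd d => fderiv ℝ u (x, p) :=
      h1.comp (Continuous.prodMk_right x)
    exact (continuous_kernel M).smul (h2.clm_comp continuous_const)
  have hbound : ∀ x p, ‖F' x p‖ ≤ (d * (shift G 0 * t)) * (‖kernel M p‖ * decay p.2) := by
    intro x p
    refine (norm_clm_le_sum _).trans ?_
    calc ∑ j, ‖F' x p (stdVec d j)‖
        ≤ ∑ _j : Fin d, shift G 0 * t * (‖kernel M p‖ * decay p.2) :=
          Finset.sum_le_sum fun j _ => (hd j).norm_kernel_mul_le x p
      _ = _ := by simp; ring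
  have hint : Integrable fun p : Rd d × Rd d =>
      (d * (shift G 0 * t)) * (‖kernel M p‖ * decay p.2) :=
    (integrable_kernel_decay hM).const_mul _
  have key : ∀ x, HasFDerivAt (kernelIntegral M u) (∫ p, F' x p) x := by
    intro x
    refine hasFDerivAt_integral_of_dominated_of_fderiv_le (F := fun x p => kernel M p * u (x, p))
      Filter.univ_mem
      (Filter.Eventually.of_forall fun y => (h.integrable_kernel_mul hM y).aestronglyMeasurable)
      (h.integrable_kernel_mul hM x) (hcont x).aestronglyMeasurable
      (Filter.Eventually.of_forall fun p y _ => hbound y p) hint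
      (Filter.Eventually.of_forall fun p y _ => ?_)
    have h1 : HasFDerivAt u (fderiv ℝ u (y, p)) (y, p) :=
      ((h.contDiff.differentiable (by simp)) (y, p)).hasFDerivAt
    have h2 := h1.comp y (hasFDerivAt_prodMk_left (𝕜 := ℝ) y p)
    exact h2.const_mul (kernel M p)
  refine ⟨fun x => (key x).differentiableAt, fun x y => ?_⟩
  have hF'int : Integrable (F' x) := hint.mono' (hcont x).aestronglyMeasurable
    (Filter.Eventually.of_forall fun p => hbound x p)
  rw [(key x).fderiv, clm_apply_eq_sum]
  refine Finset.sum_congr rfl fun j _ => ?_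
  rw [ContinuousLinearMap.integral_apply hF'int]
  rfl

theorem DerivBound.dirDeriv_kernelIntegral (hM : d < 2 * M)
    (h : DerivBound 0 G (fun v => t * decay v.2.2) u) (j : Fin d) :
    GevreyAP.dirDeriv (stdVec d j) (kernelIntegral M u) =
      kernelIntegral M (GevreyAP.dirDeriv (dir (.inl j)) u) := by
  funext x
  have h1 := (h.hasFDerivAt_kernelIntegral hM).2 x (stdVec d j)
  unfold GevreyAP.dirDeriv at h1 ⊢
  rw [h1, Finset.sum_eq_single j (fun i _ hi => by simp [stdVec, hi]) (by simp)]
  simp [stdVec]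

/-- Each partial derivative is again an integral of the same kind with a shifted sequence, so the
induction applies to it. -/
theorem DerivBound.contDiff_kernelIntegral (hM : d < 2 * M)
    (h : DerivBound 0 G (fun v => t * decay v.2.2) u) :
    ContDiff ℝ ∞ (kernelIntegral M u) := by
  rw [contDiff_infty]
  intro n
  induction n generalizing G u with
  | zero => exact contDiff_zero.2 (h.hasFDerivAt_kernelIntegral hM).1.continuous
  | succ n ih =>
    obtain ⟨h1, h2⟩ := h.hasFDerivAt_kernelIntegral hM
    rw [Nat.cast_succ]
    refine contDiff_succ_iff_fderiv_apply.2 ⟨h1, fun hn => by simp at hn, fun y => ?_⟩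
    simp only [h2]
    exact ContDiff.sum fun j _ => contDiff_const.mul (ih (h.dirDeriv (.inl j) (by simp [isXi])))

theorem DerivBound.norm_listDeriv_kernelIntegral_le (hM : d < 2 * M)
    (h : DerivBound 0 G (fun v => t * decay v.2.2) u) (l : List (Fin d)) (x : Rd d) :
    ‖listDeriv (l.map (stdVec d)) (kernelIntegral M u) x‖ ≤
      G l.length * t * ∫ p : Rd d × Rd d, ‖kernel M p‖ * decay p.2 := by
  induction l generalizing G u with
  | nil => exact h.norm_kernelIntegral_le hM x
  | cons j l ih =>
    rw [List.map_cons, listDeriv_cons, h.dirDeriv_kernelIntegral hM j]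
    exact ih (h.dirDeriv (.inl j) (by simp [isXi]))

end Smooth

/-! ### Regularized integrals -/

/-- The cutoff `χ(ε L v) χ(ε ξ)`. -/
noncomputable def cutoff {d : ℕ} (χ : Rd d → ℂ) (L : Rd3 d →L[ℝ] Rd d) (ε : ℝ) (v : Rd3 d) : ℂ :=
  χ (ε • L v) * χ (ε • v.2.2)

/-- The points where `cutoff` may differ from one. -/
def farSet {d : ℕ} (L : Rd3 d →L[ℝ] Rd d) (r ε : ℝ) (x : Rd d) : Set (Rd d × Rd d) :=
  {p | r ≤ ‖ε • L (x, p)‖ ∨ r ≤ ‖ε • p.2‖}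

theorem isClosed_farSet {d : ℕ} (L : Rd3 d →L[ℝ] Rd d) (r ε : ℝ) (x : Rd d) :
    IsClosed (farSet L r ε x) := by
  refine IsClosed.union (s₁ := {p : Rd d × Rd d | r ≤ ‖ε • L (x, p)‖})
    (s₂ := {p : Rd d × Rd d | r ≤ ‖ε • p.2‖})
    (isClosed_le continuous_const ?_) (isClosed_le continuous_const ?_)
  · exact ((L.continuous.comp (Continuous.prodMk_right x)).const_smul ε).norm
  · exact (continuous_snd.const_smul ε).norm

theorem exists_cutoff_bound {d : ℕ} {χ : Rd d → ℂ} (hχ : IsCutoff χ) :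
    ∃ G : ℕ → ℝ, (∀ n, 0 ≤ G n) ∧ ∀ (r : ℕ) (L : Rd3 d →L[ℝ] Rd d), ‖L‖ ≤ 2 →
      ∀ ε : ℝ, 0 < ε → ε ≤ 1 → DerivBound r G (fun _ => 1) (cutoff χ L ε) := by
  obtain ⟨G, hG, h⟩ := exists_derivBound_comp hχ.contDiff hχ.hasCompactSupport
  refine ⟨binConv G G, binConv_nonneg hG hG, fun r L hL ε hε hε1 => ?_⟩
  set L₂ : Rd3 d →L[ℝ] Rd d :=
    (ContinuousLinearMap.snd ℝ _ _).comp (ContinuousLinearMap.snd ℝ _ _) with hL₂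
  have hL₂n : ‖L₂‖ ≤ 2 := by
    refine ContinuousLinearMap.opNorm_le_bound _ zero_le_two fun v => ?_
    have h1 : ‖v.2.2‖ ≤ ‖v‖ := (norm_snd_le v.2).trans (norm_snd_le v)
    have h2 : L₂ v = v.2.2 := rfl
    rw [h2]
    linarith [norm_nonneg v]
  have hs : ∀ L : Rd3 d →L[ℝ] Rd d, ‖L‖ ≤ 2 → ‖ε • L‖ ≤ 2 := by
    intro L hL
    rw [norm_smul, Real.norm_eq_abs, abs_of_pos hε]
    nlinarith [norm_nonneg L]
  have h1 := (h r (ε • L) (hs L hL)).mul (h r (ε • L₂) (hs L₂ hL₂n))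
  simp only [mul_one] at h1
  exact h1

theorem hasCompactSupport_cutoff_mul {d : ℕ} {χ : Rd d → ℂ} (hχ : IsCutoff χ)
    {L : Rd3 d →L[ℝ] Rd d} (hL : ∀ x p, ‖p.1‖ ≤ ‖L (x, p)‖ + ‖x‖) {ε : ℝ} (hε : 0 < ε)
    (u : Rd3 d → ℂ) (x : Rd d) :
    HasCompactSupport fun p => (cutoff χ L ε * u) (x, p) := by
  obtain ⟨R, hR⟩ := hχ.hasCompactSupport.isCompact.isBounded.exists_norm_le
  refine HasCompactSupport.intro (isCompact_closedBall (0 : Rd d × Rd d) (R / ε + ‖x‖))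
    fun p hp => ?_
  by_contra hne
  have h1 : cutoff χ L ε (x, p) ≠ 0 := left_ne_zero_of_mul hne
  have h2 := hR _ (subset_tsupport χ (left_ne_zero_of_mul h1))
  have h3 := hR _ (subset_tsupport χ (right_ne_zero_of_mul h1))
  rw [norm_smul, Real.norm_eq_abs, abs_of_pos hε, mul_comm, ← le_div_iff₀ hε] at h2 h3
  apply hp
  rw [mem_closedBall_zero_iff, Prod.norm_def]
  exact max_le ((hL x p).trans (by linarith)) (h3.trans (by linarith [norm_nonneg x]))

/-- Both integrands have one majorant and coincide off `farSet`. The constants do not depend on `L`,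
`ε` or `x`: `L = x - z` gives the limit in the definition of the operator, `L = z` an approximation
uniform in `x`. -/
theorem exists_norm_sub_le {d M m₀ : ℕ} (hM : d < 2 * M) {χ : Rd d → ℂ} (hχ : IsCutoff χ)
    {G : ℕ → ℝ} (hG : ∀ n, 0 ≤ G n) {t : ℝ} (ht : 0 ≤ t) {u : Rd3 d → ℂ}
    (hu : DerivBound (2 * M) G (fun v => t * japanese v.2.2 ^ m₀) u) :
    ∃ A : ℝ, ∃ r > (0 : ℝ), ∀ L : Rd3 d →L[ℝ] Rd d, ‖L‖ ≤ 2 →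
      (∀ x p, ‖p.1‖ ≤ ‖L (x, p)‖ + ‖x‖) → ∀ ε : ℝ, 0 < ε → ε ≤ 1 → ∀ x,
      ‖(∫ p, wave p * (cutoff χ L ε * u) (x, p)) - kernelIntegral M (reduce M m₀ u) x‖ ≤
        A * ∫ p, (farSet L r ε x).indicator (fun p => ‖kernel M p‖ * decay p.2) p := by
  obtain ⟨Gχ, hGχ, hcut⟩ := exists_cutoff_bound hχ
  -- The Gevrey exponent `1` is a dummy value: only the terms of index `0` are used below.
  obtain ⟨G₁, hG₁, -, hr₁⟩ := exists_reduce_bound (d := d) M m₀ 1 le_rfl hG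
  obtain ⟨G₂, hG₂, -, hr₂⟩ := exists_reduce_bound (d := d) M m₀ 1 le_rfl (binConv_nonneg hGχ hG)
  obtain ⟨r, hr, hball⟩ := Metric.eventually_nhds_iff_ball.1 hχ.eventually_eq_one
  refine ⟨(G₁ 0 + G₂ 0) * t, r, hr, fun L hL hLz ε hε hε1 x => ?_⟩
  have hb₁ := hr₁ t u ht hu
  have hmul := (hcut (2 * M) L hL ε hε hε1).mul hu
  simp only [one_mul] at hmul
  have hb₂ := hr₂ t _ ht hmul
  rw [← integral_reduce M m₀ hmul.contDiff (hasCompactSupport_cutoff_mul hχ hLz hε u x)]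
  rw [kernelIntegral, ← integral_sub (hb₂.integrable_kernel_mul hM x)
    (hb₁.integrable_kernel_mul hM x), ← integral_const_mul]
  refine norm_integral_le_of_norm_le (((integrable_kernel_decay hM).indicator
    (isClosed_farSet L r ε x).measurableSet).const_mul _)
    (Filter.Eventually.of_forall fun p => ?_)
  by_cases hp : p ∈ farSet L r ε x
  · rw [Set.indicator_of_mem hp]
    refine (norm_sub_le _ _).trans ((add_le_add (hb₂.norm_kernel_mul_le x p)
      (hb₁.norm_kernel_mul_le x p)).trans (le_of_eq (by ring)))
  · rw [Set.indicator_of_notMem hp, mul_zero, norm_le_zero_iff, sub_eq_zero]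
    congr 1
    refine reduce_congr M m₀ ?_
    simp only [farSet, Set.mem_ofPred_eq, not_or, not_le] at hp
    have e1 : ∀ᶠ v in 𝓝 ((x, p) : Rd3 d), ‖ε • L v‖ < r :=
      (L.continuous.const_smul ε).norm.continuousAt.eventually_lt continuousAt_const hp.1
    have e2 : ∀ᶠ v in 𝓝 ((x, p) : Rd3 d), ‖ε • v.2.2‖ < r :=
      ((continuous_snd.comp continuous_snd).const_smul ε).norm.continuousAt.eventually_lt
        continuousAt_const hp.2
    filter_upwards [e1, e2] with v h1 h2
    simp only [Pi.mul_apply, cutoff]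
    rw [hball _ (by simpa using h1), hball _ (by simpa using h2)]
    ring

/-- Dominated convergence: a fixed point leaves `farSet` once `ε` is small. -/
theorem tendsto_integral_farSet {d M : ℕ} (hM : d < 2 * M) (L : Rd3 d →L[ℝ] Rd d) {r : ℝ}
    (hr : 0 < r) (x : Rd d) :
    Filter.Tendsto (fun ε : ℝ => ∫ p, (farSet L r ε x).indicator
      (fun p => ‖kernel M p‖ * decay p.2) p) (𝓝[>] 0) (𝓝 0) := by
  have h := tendsto_integral_filter_of_dominated_convergence (μ := volume) (l := 𝓝[>] (0 : ℝ))
    (F := fun (ε : ℝ) p => (farSet L r ε x).indicator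
      (fun p : Rd d × Rd d => ‖kernel M p‖ * decay p.2) p) (f := fun _ => 0)
    (fun p => ‖kernel M p‖ * decay p.2) ?_ ?_ (integrable_kernel_decay hM) ?_
  · simpa using h
  · exact Filter.Eventually.of_forall fun ε => ((integrable_kernel_decay hM).indicator
      (isClosed_farSet L r ε x).measurableSet).aestronglyMeasurable
  · refine Filter.Eventually.of_forall fun ε => Filter.Eventually.of_forall fun p => ?_
    rw [Real.norm_eq_abs, abs_of_nonneg (Set.indicator_nonneg (fun p _ => mul_nonneg (norm_nonneg (kernel M p)) (decay_nonneg p.2)) p)]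
    exact Set.indicator_le_self' (fun p _ => mul_nonneg (norm_nonneg (kernel M p)) (decay_nonneg p.2)) p
  · refine Filter.Eventually.of_forall fun p => ?_
    refine tendsto_const_nhds.congr' ?_
    have e : ∀ w : Rd d, ∀ᶠ ε : ℝ in 𝓝[>] 0, ‖ε • w‖ < r := by
      intro w
      have hc : ContinuousAt (fun ε : ℝ => ‖ε • w‖) 0 :=
        (continuous_id.smul continuous_const).norm.continuousAt
      exact (hc.eventually_lt continuousAt_const (by simpa using hr)).filter_mono
        nhdsWithin_le_nhds
    filter_upwards [e (L (x, p)), e p.2] with ε h1 h2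
    rw [Set.indicator_of_notMem]
    simp only [farSet, Set.mem_ofPred_eq, not_or, not_le]
    exact ⟨h1, h2⟩
/-! ### Almost periodicity through finite colourings of the translates -/

/-- For every `ε > 0` the translates of `h` can be coloured with finitely many colours so that
translates of the same colour are uniformly `ε`-close (Bochner's criterion). -/
def FinitelyColored {V : Type} [NormedAddCommGroup V] (h : V → ℂ) : Prop :=
  ∀ ε > 0, ∃ (κ : Type) (_ : Finite κ) (c : V → κ), ∀ t t', c t = c t' →
    ∀ x, ‖h (x + t) - h (x + t')‖ ≤ ε

section Coloring

variable {V V' : Type} [NormedAddCommGroup V] [NormedAddCommGroup V']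

theorem IsAlmostPeriodic.finitelyColored {h : V → ℂ} (hh : IsAlmostPeriodic h) :
    FinitelyColored h := by
  intro ε hε
  obtain ⟨F, hF, H⟩ := hh.exists_finite (half_pos hε)
  choose p hp hp' using H
  refine ⟨F, hF.to_subtype, fun t => ⟨p t, hp t⟩, fun t t' htt x => ?_⟩
  have e : p t = p t' := congrArg Subtype.val htt
  have h1 := hp' t x
  have h2 := hp' t' x
  rw [← e, norm_sub_rev] at h2
  calc ‖h (x + t) - h (x + t')‖ = ‖(h (x + t) - h (x + p t)) + (h (x + p t) - h (x + t'))‖ := by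
        congr 1; abel
    _ ≤ ‖h (x + t) - h (x + p t)‖ + ‖h (x + p t) - h (x + t')‖ := norm_add_le _ _
    _ ≤ ε := by linarith

theorem FinitelyColored.isAlmostPeriodic {h : V → ℂ} (hh : FinitelyColored h)
    (hc : Continuous h) (hb : ∃ R : ℝ, ∀ x, ‖h x‖ ≤ R) : IsAlmostPeriodic h := by
  refine ⟨hc, hb, fun ε hε => ?_⟩
  obtain ⟨κ, hκ, c, H⟩ := hh (ε / 2) (half_pos hε)
  have hr : ∀ y : Set.range c, ∃ x, c x = y.1 := fun y => y.2
  choose r hr using hr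
  refine ⟨Set.range r, (Set.finite_range r).isCompact, fun x => ?_⟩
  -- The representative of the colour of `-x`; then `x + w` is an almost period.
  set w := r ⟨c (-x), ⟨-x, rfl⟩⟩ with hw
  refine ⟨w, ⟨_, rfl⟩, ε / 2, half_lt_self hε, fun z => ?_⟩
  have h1 := H w (-x) (hr _) (z + x)
  rwa [add_neg_cancel_right, add_assoc] at h1

theorem FinitelyColored.comp {h : V' → ℂ} (hh : FinitelyColored h) (i : V → V')
    (hi : ∀ x y, i (x + y) = i x + i y) (w : V') : FinitelyColored fun x => h (i x + w) := by
  intro ε hε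
  obtain ⟨κ, hκ, c, H⟩ := hh ε hε
  refine ⟨κ, hκ, fun t => c (i t), fun t t' htt x => ?_⟩
  have := H _ _ htt (i x + w)
  rwa [add_right_comm, ← hi, add_right_comm (i x) w (i t'), ← hi] at this

theorem FinitelyColored.mul {h g : V → ℂ} (hh : FinitelyColored h) (hg : FinitelyColored g)
    (hhb : ∃ R : ℝ, ∀ x, ‖h x‖ ≤ R) (hgb : ∃ R : ℝ, ∀ x, ‖g x‖ ≤ R) :
    FinitelyColored fun x => h x * g x := by
  intro ε hε
  obtain ⟨R, hR⟩ := hhb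
  obtain ⟨S, hS⟩ := hgb
  have hR0 : 0 ≤ R := (norm_nonneg _).trans (hR 0)
  have hS0 : 0 ≤ S := (norm_nonneg _).trans (hS 0)
  obtain ⟨κ, hκ, c, H⟩ := hh (ε / (R + S + 1)) (by positivity)
  obtain ⟨κ', hκ', c', H'⟩ := hg (ε / (R + S + 1)) (by positivity)
  refine ⟨κ × κ', inferInstance, fun t => (c t, c' t), fun t t' htt x => ?_⟩
  obtain ⟨h1, h2⟩ := Prod.mk.inj htt
  calc ‖h (x + t) * g (x + t) - h (x + t') * g (x + t')‖
      = ‖h (x + t) * (g (x + t) - g (x + t')) + (h (x + t) - h (x + t')) * g (x + t')‖ := by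
        congr 1; ring
    _ ≤ ‖h (x + t)‖ * ‖g (x + t) - g (x + t')‖ + ‖h (x + t) - h (x + t')‖ * ‖g (x + t')‖ := by
        rw [← norm_mul, ← norm_mul]; exact norm_add_le _ _
    _ ≤ R * (ε / (R + S + 1)) + ε / (R + S + 1) * S := by
        gcongr
        · exact hR _
        · exact H' _ _ h2 x
        · exact H _ _ h1 x
        · exact hS _
    _ = ε * ((R + S) / (R + S + 1)) := by ring
    _ ≤ ε := mul_le_of_le_one_right hε.le ((div_le_one (by positivity)).2 (by linarith))

theorem FinitelyColored.of_uniform_limit {h : V → ℂ}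
    (H : ∀ ε > 0, ∃ g : V → ℂ, FinitelyColored g ∧ ∀ x, ‖g x - h x‖ ≤ ε) :
    FinitelyColored h := by
  intro ε hε
  obtain ⟨g, hg, hgh⟩ := H (ε / 3) (by positivity)
  obtain ⟨κ, hκ, c, hc⟩ := hg (ε / 3) (by positivity)
  refine ⟨κ, hκ, c, fun t t' htt x => ?_⟩
  have h1 := hgh (x + t)
  have h2 := hgh (x + t')
  have h3 := hc t t' htt x
  rw [norm_sub_rev] at h1
  calc ‖h (x + t) - h (x + t')‖ = ‖(h (x + t) - g (x + t)) + (g (x + t) - g (x + t')) +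
        (g (x + t') - h (x + t'))‖ := by congr 1; abel
    _ ≤ ‖h (x + t) - g (x + t)‖ + ‖g (x + t) - g (x + t')‖ + ‖g (x + t') - h (x + t')‖ :=
        norm_add₃_le
    _ ≤ ε := by linarith

/-- Integrals over a compact set of a family of almost periodic functions depending
continuously on the parameter. -/
theorem FinitelyColored.integral {P : Type} [TopologicalSpace P] [MeasurableSpace P]
    [OpensMeasurableSpace P] {μ : Measure P} [IsFiniteMeasureOnCompacts μ]
    {φ : P → ℂ} (hφ : Continuous φ) (hφc : HasCompactSupport φ) {u : V → P → ℂ}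
    (hu : ∀ p, FinitelyColored fun x => u x p) (huc : ∀ x, Continuous (u x))
    (heq : ∀ p, ∀ η > 0, ∀ᶠ q in 𝓝 p, ∀ x, ‖u x q - u x p‖ ≤ η) :
    FinitelyColored fun x => ∫ p, φ p * u x p ∂μ := by
  intro ε hε
  have hint : Integrable φ μ := hφ.integrable_of_hasCompactSupport hφc
  set I := ∫ p, ‖φ p‖ ∂μ with hI
  have hI0 : 0 ≤ I := integral_nonneg fun _ => norm_nonneg _
  set η := ε / (3 * (I + 1)) with hη
  have hη0 : 0 < η := by positivity
  choose κ hκ c hc using fun p => hu p η hη0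
  obtain ⟨T, -, hT⟩ := hφc.isCompact.elim_nhds_subcover _ fun p _ => heq p η hη0
  -- Finitely many parameters approximate all those in the support of `φ`, so the tuple of their
  -- colours is still a finite colouring. The three terms of size `η` explain the `3` in its
  -- definition.
  refine ⟨∀ p : T, κ p, inferInstance, fun t p => c p t, fun t t' htt x => ?_⟩
  have hix : ∀ x, Integrable (fun p => φ p * u x p) μ := fun x =>
    (hφ.mul (huc x)).integrable_of_hasCompactSupport hφc.mul_right
  rw [← integral_sub (hix _) (hix _)]
  have hb : ∀ p, ‖φ p * u (x + t) p - φ p * u (x + t') p‖ ≤ (3 * η) * ‖φ p‖ := by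
    intro p
    by_cases hp : p ∈ tsupport φ
    · obtain ⟨q, hq, hpq⟩ := Set.mem_iUnion₂.1 (hT hp)
      have hpq' : ∀ x, ‖u x p - u x q‖ ≤ η := hpq
      have h1 := hc q t t' (congrFun htt ⟨q, hq⟩) x
      have h2 := hpq' (x + t)
      have h3 := hpq' (x + t')
      rw [norm_sub_rev] at h3
      rw [← mul_sub, norm_mul, mul_comm]
      refine mul_le_mul_of_nonneg_right ?_ (norm_nonneg _)
      calc ‖u (x + t) p - u (x + t') p‖ = ‖(u (x + t) p - u (x + t) q) +
            (u (x + t) q - u (x + t') q) + (u (x + t') q - u (x + t') p)‖ := by congr 1; abel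
        _ ≤ ‖u (x + t) p - u (x + t) q‖ + ‖u (x + t) q - u (x + t') q‖ +
            ‖u (x + t') q - u (x + t') p‖ := norm_add₃_le
        _ ≤ 3 * η := by linarith
    · rw [image_eq_zero_of_notMem_tsupport hp]
      simp
  refine (norm_integral_le_of_norm_le (hint.norm.const_mul _)
    (Filter.Eventually.of_forall hb)).trans ?_
  rw [integral_const_mul, ← hI, hη]
  calc 3 * (ε / (3 * (I + 1))) * I = ε * (I / (I + 1)) := by field_simp
    _ ≤ ε := mul_le_of_le_one_right hε.le ((div_le_one (by positivity)).2 (by linarith))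

end Coloring

/-! ### The integrand in the variables `(x, z, ξ)` -/

/-- The function `a(x, x - z, ξ) f(x - z)`. -/
noncomputable def integrand {d : ℕ} (a : Rd3 d → ℂ) (f : Rd d → ℂ) : Rd3 d → ℂ :=
  (a * fun v => f v.2.1) ∘ shear d

theorem integrand_apply {d : ℕ} (a : Rd3 d → ℂ) (f : Rd d → ℂ) (x : Rd d) (p : Rd d × Rd d) :
    integrand a f (x, p) = a (x, x - p.1, p.2) * f (x - p.1) := rfl

theorem contDiff_integrand {d : ℕ} {a : Rd3 d → ℂ} {f : Rd d → ℂ} (ha : ContDiff ℝ ∞ a)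
    (hf : ContDiff ℝ ∞ f) : ContDiff ℝ ∞ (integrand a f) :=
  ContDiff.comp (g := a * fun v => f v.2.1)
    (ContDiff.mul ha (hf.comp (contDiff_fst.comp contDiff_snd))) (shear d).contDiff

theorem DerivBound.integrand {d M m₀ : ℕ} {G : ℕ → ℝ} (hG : ∀ n, 0 ≤ G n) {a : Rd3 d → ℂ}
    (ha : DerivBound (2 * M) G (fun v => japanese v.2.2 ^ m₀) a) {s : ℝ} (hs : 0 ≤ s)
    {C : {C : ℝ // 0 < C}} (f : Step d s C) :
    DerivBound (2 * M)
      (fun n => 2 ^ n * binConv G (fun n => C.1 ^ n * (n.factorial : ℝ) ^ s) n)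
      (fun v => ‖f‖ * japanese v.2.2 ^ m₀) (GevreyAP.integrand a f.1) := by
  have hC : ∀ n : ℕ, 0 ≤ C.1 ^ n * (n.factorial : ℝ) ^ s := fun n =>
    mul_nonneg (pow_nonneg C.2.le _) (by positivity)
  have hf := DerivBound.of_middle (r := 2 * M) hC (norm_nonneg f) (MemStep.contDiff f.2)
    (f.norm_listDeriv_le hs)
  have h := (ha.mul hf).comp_shear (binConv_nonneg hG hC) fun v =>
    mul_nonneg (pow_nonneg (zero_le_one.trans (one_le_japanese _)) _) (norm_nonneg f)
  simp only [shear_apply, mul_comm _ ‖f‖] at h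
  exact h

theorem norm_clm_prod_le_sum {d : ℕ} (L : Rd d × Rd d →L[ℝ] ℂ) :
    ‖L‖ ≤ ∑ j, ‖L (stdVec d j, 0)‖ + ∑ j, ‖L (0, stdVec d j)‖ := by
  have h1 := norm_clm_le_sum (L.comp (ContinuousLinearMap.inl ℝ (Rd d) (Rd d)))
  have h2 := norm_clm_le_sum (L.comp (ContinuousLinearMap.inr ℝ (Rd d) (Rd d)))
  refine le_trans ?_ (add_le_add h1 h2)
  refine L.opNorm_le_bound (by positivity) fun p => ?_
  have e : L p = L.comp (ContinuousLinearMap.inl ℝ (Rd d) (Rd d)) p.1 +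
      L.comp (ContinuousLinearMap.inr ℝ (Rd d) (Rd d)) p.2 := by
    simp [← map_add]
  rw [e, add_mul]
  refine (norm_add_le _ _).trans (add_le_add ?_ ?_)
  · exact (ContinuousLinearMap.le_opNorm _ _).trans
      (mul_le_mul_of_nonneg_left (norm_fst_le p) (norm_nonneg _))
  · exact (ContinuousLinearMap.le_opNorm _ _).trans
      (mul_le_mul_of_nonneg_left (norm_snd_le p) (norm_nonneg _))

theorem japanese_le {d : ℕ} (ξ : Rd d) : japanese ξ ≤ 1 + ‖ξ‖ := by
  unfold japanese
  rw [Real.sqrt_le_left (by positivity)]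
  nlinarith [norm_nonneg ξ]

/-- Local Lipschitz continuity in `(z, ξ)`, uniformly in `x`. -/
theorem DerivBound.eventually_norm_sub_le {d r m₀ : ℕ} (hr : 0 < r) {G : ℕ → ℝ}
    (hG : ∀ n, 0 ≤ G n) {t : ℝ} (ht : 0 ≤ t) {u : Rd3 d → ℂ}
    (hu : DerivBound r G (fun v => t * japanese v.2.2 ^ m₀) u) (p : Rd d × Rd d) {η : ℝ}
    (hη : 0 < η) : ∀ᶠ q in 𝓝 p, ∀ x, ‖u (x, q) - u (x, p)‖ ≤ η := by
  -- A bound for the gradient in `(z, ξ)` on the unit ball around `p`, where `⟨ξ⟩ ≤ 2 + ‖p‖`.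
  set K := 2 * d * (G 1 * (t * (2 + ‖p‖) ^ m₀)) with hK
  have hK0 : 0 ≤ K := by have := hG 1; positivity
  have hδ : 0 < min 1 (η / (K + 1)) := lt_min one_pos (by positivity)
  filter_upwards [Metric.ball_mem_nhds p hδ] with q hq x
  have hpart : ∀ (i : Var d) (w : Rd d × Rd d), w ∈ Metric.ball p 1 →
      ‖GevreyAP.dirDeriv (dir i) u (x, w)‖ ≤ G 1 * (t * (2 + ‖p‖) ^ m₀) := by
    intro i w hw
    have h1 := (hu.dirDeriv (r' := 0) i (by split_ifs <;> omega)).norm_le (x, w)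
    refine h1.trans (mul_le_mul_of_nonneg_left (mul_le_mul_of_nonneg_left
      (pow_le_pow_left₀ (zero_le_one.trans (one_le_japanese _)) ?_ _) ht) (hG 1))
    have h2 : ‖w‖ ≤ 1 + ‖p‖ := by
      have h3 : ‖w - p‖ < 1 := by rw [← dist_eq_norm]; exact hw
      have h4 := norm_add_le (w - p) p
      rw [sub_add_cancel] at h4
      linarith
    have h5 := japanese_le w.2
    have h6 := norm_snd_le w
    linarith
  have hd : ∀ w ∈ Metric.ball p 1, ‖fderiv ℝ (fun q => u (x, q)) w‖ ≤ K := by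
    intro w hw
    refine (norm_clm_prod_le_sum _).trans ?_
    have e1 : ∀ j, fderiv ℝ (fun q => u (x, q)) w (stdVec d j, 0) =
        GevreyAP.dirDeriv (dir (.inr (.inl j))) u (x, w) := fun j =>
      (congrFun (dirDeriv_slice hu.contDiff x (stdVec d j, 0)) w).symm
    have e2 : ∀ j, fderiv ℝ (fun q => u (x, q)) w (0, stdVec d j) =
        GevreyAP.dirDeriv (dir (.inr (.inr j))) u (x, w) := fun j =>
      (congrFun (dirDeriv_slice hu.contDiff x (0, stdVec d j)) w).symm
    simp only [e1, e2]
    refine (add_le_add (Finset.sum_le_sum fun j _ => hpart _ w hw)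
      (Finset.sum_le_sum fun j _ => hpart _ w hw)).trans (le_of_eq ?_)
    simp only [Finset.sum_const, Finset.card_univ, Fintype.card_fin, nsmul_eq_mul, hK]
    ring
  have hq1 : q ∈ Metric.ball p 1 := Metric.ball_subset_ball (min_le_left _ _) hq
  have h := (convex_ball p 1).norm_image_sub_le_of_norm_fderiv_le
    (fun w _ => ((contDiff_slice hu.contDiff x).differentiable (by simp)) w) hd
    (Metric.mem_ball_self one_pos) hq1
  have hq2 : ‖q - p‖ ≤ η / (K + 1) := by
    rw [← dist_eq_norm]
    exact (lt_of_lt_of_le hq (min_le_right _ _)).le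
  refine h.trans ((mul_le_mul_of_nonneg_left hq2 hK0).trans ?_)
  rw [← mul_div_assoc, div_le_iff₀ (by positivity)]
  nlinarith

theorem IsAmplitude.finitelyColored_integrand {d : ℕ} {ρ m s s' C : ℝ} {a : Rd3 d → ℂ}
    (ha : IsAmplitude d ρ 0 m s a) {f : Rd d → ℂ} (hf : MemStep d s' C f) (p : Rd d × Rd d) :
    FinitelyColored fun x => integrand a f (x, p) := by
  -- Joint almost periodicity in `(x, y)` is restricted to the shifted diagonal `x ↦ (x, x - z)`.
  have h1 := (ha.almostPeriodic p.2).finitelyColored.comp (fun x : Rd d => (x, x))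
    (fun _ _ => rfl) (0, -p.1)
  have h2 := hf.almostPeriodic.finitelyColored.comp id (fun _ _ => rfl) (-p.1)
  obtain ⟨R, hR⟩ := (ha.almostPeriodic p.2).bounded
  obtain ⟨S, hS⟩ := hf.almostPeriodic.bounded
  have h3 := h1.mul h2 ⟨R, fun x => hR _⟩ ⟨S, fun x => hS _⟩
  simpa [integrand_apply, sub_eq_add_neg] using h3
/-! ### The operator -/

/-- `(x, z, ξ) ↦ x - z`. -/
noncomputable def diffMap (d : ℕ) : Rd3 d →L[ℝ] Rd d :=
  ContinuousLinearMap.fst ℝ (Rd d) (Rd d × Rd d) -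
    (ContinuousLinearMap.fst ℝ (Rd d) (Rd d)).comp
      (ContinuousLinearMap.snd ℝ (Rd d) (Rd d × Rd d))

/-- `(x, z, ξ) ↦ z`. -/
noncomputable def middleMap (d : ℕ) : Rd3 d →L[ℝ] Rd d :=
  (ContinuousLinearMap.fst ℝ (Rd d) (Rd d)).comp
    (ContinuousLinearMap.snd ℝ (Rd d) (Rd d × Rd d))

theorem norm_diffMap_le (d : ℕ) : ‖diffMap d‖ ≤ 2 := by
  refine ContinuousLinearMap.opNorm_le_bound _ zero_le_two fun v => ?_
  have h1 := norm_fst_le v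
  have h2 := (norm_fst_le v.2).trans (norm_snd_le v)
  have h3 : ‖diffMap d v‖ ≤ ‖v.1‖ + ‖v.2.1‖ := norm_sub_le _ _
  linarith

theorem norm_middleMap_le (d : ℕ) : ‖middleMap d‖ ≤ 2 := by
  refine ContinuousLinearMap.opNorm_le_bound _ zero_le_two fun v => ?_
  have h2 := (norm_fst_le v.2).trans (norm_snd_le v)
  have h3 : ‖middleMap d v‖ = ‖v.2.1‖ := rfl
  linarith [norm_nonneg v]

theorem norm_le_diffMap {d : ℕ} (x : Rd d) (p : Rd d × Rd d) :
    ‖p.1‖ ≤ ‖diffMap d (x, p)‖ + ‖x‖ := by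
  have h := norm_sub_le x (x - p.1)
  rw [sub_sub_cancel] at h
  have e : diffMap d (x, p) = x - p.1 := rfl
  rw [e]
  linarith

theorem norm_le_middleMap {d : ℕ} (x : Rd d) (p : Rd d × Rd d) :
    ‖p.1‖ ≤ ‖middleMap d (x, p)‖ + ‖x‖ := le_add_of_nonneg_right (norm_nonneg x)

theorem regularizedIntegral_eq {d : ℕ} (χ : Rd d → ℂ) (a : Rd3 d → ℂ) (f : Rd d → ℂ) (x : Rd d)
    (ε : ℝ) : regularizedIntegral χ a f x ε =
      ∫ p, wave p * (cutoff χ (diffMap d) ε * integrand a f) (x, p) := by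
  let φ : Rd d × Rd d ≃ₜ Rd d × Rd d := (Homeomorph.subLeft x).prodCongr (Homeomorph.refl _)
  have hφ : MeasurePreserving φ (volume : Measure (Rd d × Rd d)) volume :=
    ((volume : Measure (Rd d)).measurePreserving_sub_left x).prod
      (MeasurePreserving.id (volume : Measure (Rd d)))
  unfold regularizedIntegral
  rw [← hφ.integral_comp φ.measurableEmbedding]
  refine integral_congr_ae (Filter.Eventually.of_forall fun p => ?_)
  have e : φ p = (x - p.1, p.2) := rfl
  have e' : diffMap d (x, p) = x - p.1 := rfl
  simp only [e, Pi.mul_apply, cutoff, wave, integrand_apply, e', sub_sub_cancel]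
  ring

theorem exists_isCutoff (d : ℕ) : ∃ χ : Rd d → ℂ, IsCutoff χ := by
  let φ : ContDiffBump (0 : Rd d) := ⟨1, 2, one_pos, one_lt_two⟩
  refine ⟨fun y => (φ y : ℂ), Complex.ofRealCLM.contDiff.comp φ.contDiff,
    φ.hasCompactSupport.comp_left Complex.ofReal_zero, ?_⟩
  filter_upwards [φ.eventuallyEq_one] with y hy
  rw [hy]
  simp

/-- The absolutely convergent expression of `a(x,D) f`. -/
noncomputable def operatorFun {d : ℕ} (M m₀ : ℕ) (a : Rd3 d → ℂ) (f : Rd d → ℂ) : Rd d → ℂ :=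
  kernelIntegral M (reduce M m₀ (integrand a f))

section Operator

variable {d M m₀ : ℕ} {ρ m s : ℝ} {G : ℕ → ℝ} {a : Rd3 d → ℂ}

theorem integrand_seq_nonneg (hG : ∀ n, 0 ≤ G n) {C : ℝ} (hC : 0 < C) (s : ℝ) (n : ℕ) :
    0 ≤ 2 ^ n * binConv G (fun n => C ^ n * (n.factorial : ℝ) ^ s) n :=
  mul_nonneg (by positivity) (binConv_nonneg hG (fun n => by positivity) n)

theorem isOperatorValue_operatorFun (hs : 0 ≤ s) (hM : d < 2 * M) (hG : ∀ n, 0 ≤ G n)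
    (ha : DerivBound (2 * M) G (fun v => japanese v.2.2 ^ m₀) a) {C : {C : ℝ // 0 < C}}
    (f : Step d s C) : IsOperatorValue a f.1 (operatorFun M m₀ a f.1) := by
  intro χ hχ x
  obtain ⟨A, r, hr, h⟩ := exists_norm_sub_le hM hχ (integrand_seq_nonneg hG C.2 s) (norm_nonneg f)
    (ha.integrand hG hs f)
  rw [tendsto_iff_norm_sub_tendsto_zero]
  have h0 := (tendsto_integral_farSet hM (diffMap d) hr x).const_mul A
  rw [mul_zero] at h0
  refine squeeze_zero' (Filter.Eventually.of_forall fun _ => norm_nonneg _) ?_ h0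
  filter_upwards [Ioc_mem_nhdsGT (zero_lt_one (α := ℝ))] with ε hε
  rw [regularizedIntegral_eq]
  exact h _ (norm_diffMap_le d) norm_le_diffMap ε hε.1 hε.2 x

theorem isAlmostPeriodic_operatorFun (hs : 0 ≤ s) (hM : d < 2 * M) (hG : ∀ n, 0 ≤ G n)
    (ha : DerivBound (2 * M) G (fun v => japanese v.2.2 ^ m₀) a) (hap : IsAmplitude d ρ 0 m s a)
    {C : {C : ℝ // 0 < C}} (f : Step d s C) (hc : Continuous (operatorFun M m₀ a f.1))
    (hb : ∃ R : ℝ, ∀ x, ‖operatorFun M m₀ a f.1 x‖ ≤ R) :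
    IsAlmostPeriodic (operatorFun M m₀ a f.1) := by
  refine FinitelyColored.isAlmostPeriodic (FinitelyColored.of_uniform_limit fun η hη => ?_) hc hb
  obtain ⟨χ, hχ⟩ := exists_isCutoff d
  have hu := ha.integrand hG hs f
  have hG' := integrand_seq_nonneg hG C.2 s
  obtain ⟨A, r, hr, h⟩ := exists_norm_sub_le hM hχ hG' (norm_nonneg f) hu
  -- For the cutoff in `z` the far set does not depend on `x`, so the choice of `ε` at `x = 0`
  -- serves every `x`.
  have h0 := (tendsto_integral_farSet hM (middleMap d) hr 0).const_mul A
  rw [mul_zero] at h0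
  obtain ⟨ε, hε, hlt⟩ := ((Filter.eventually_mem_set.2 (Ioc_mem_nhdsGT (zero_lt_one (α := ℝ)))).and
    (h0.eventually (gt_mem_nhds hη))).exists
  refine ⟨fun x => ∫ p, wave p * (cutoff χ (middleMap d) ε * integrand a f.1) (x, p), ?_,
    fun x => (h _ (norm_middleMap_le d) norm_le_middleMap ε hε.1 hε.2 x).trans hlt.le⟩
  have hcut : ContDiff ℝ ∞ (cutoff χ (middleMap d) ε) := by
    obtain ⟨_, -, hcb⟩ := exists_cutoff_bound hχ
    exact (hcb 0 _ (norm_middleMap_le d) ε hε.1 hε.2).contDiff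
  have hcs := hasCompactSupport_cutoff_mul hχ norm_le_middleMap hε.1 (fun _ => 1) (0 : Rd d)
  simp only [Pi.mul_apply, mul_one] at hcs
  have key := FinitelyColored.integral (μ := (volume : Measure (Rd d × Rd d)))
    (φ := fun p => wave p * cutoff χ (middleMap d) ε (0, p))
    (contDiff_wave.continuous.mul (contDiff_slice hcut 0).continuous) hcs.mul_left
    (u := fun x p => integrand a f.1 (x, p)) (fun p => hap.finitelyColored_integrand f.2 p)
    (fun x => (contDiff_slice hu.contDiff x).continuous)
    (fun p η hη => hu.eventually_norm_sub_le (by omega) hG' (norm_nonneg f) p hη)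
  refine (congrArg FinitelyColored (funext fun x => ?_)).mp key
  refine integral_congr_ae (Filter.Eventually.of_forall fun p => ?_)
  have e : cutoff χ (middleMap d) ε (x, p) = cutoff χ (middleMap d) ε (0, p) := rfl
  simp only [Pi.mul_apply, e]
  ring

/-- The norm of `f` enters only as a scalar in the weight, so the Gevrey constants of the image
depend on `C` but not on `f`. -/
theorem exists_step_bound (hs : 1 ≤ s) (hM : d < 2 * M) (hG : IsGevSeq s G)
    (ha : DerivBound (2 * M) G (fun v => japanese v.2.2 ^ m₀) a) (hap : IsAmplitude d ρ 0 m s a)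
    (C : {C : ℝ // 0 < C}) :
    ∃ (C' : {C : ℝ // 0 < C}) (A : ℝ), ∀ f : Step d s C,
      MemStep d s C'.1 (operatorFun M m₀ a f.1) ∧
        ∀ q, weighted d s C'.1 (operatorFun M m₀ a f.1) q ≤ A * ‖f‖ := by
  have hs0 : 0 ≤ s := by linarith
  have hG0 := integrand_seq_nonneg hG.1 C.2 s
  have hGC : IsGevSeq s (fun n : ℕ => C.1 ^ n * (n.factorial : ℝ) ^ s) :=
    ⟨fun n => mul_nonneg (pow_nonneg C.2.le _) (by positivity), 1, one_pos, C.1, C.2,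
      fun n => by rw [one_mul]⟩
  obtain ⟨G₁, hG₁, hgev, hred⟩ := exists_reduce_bound (d := d) M m₀ s hs hG0
  obtain ⟨-, A₁, hA₁, C₁, hC₁, hle⟩ := hgev ((hG.binConv hs0 hGC).pow_mul two_pos)
  set I := ∫ p : Rd d × Rd d, ‖kernel M p‖ * decay p.2 with hI
  have hI0 : 0 ≤ I := integral_nonneg fun p => mul_nonneg (norm_nonneg _) (decay_nonneg _)
  have h2d : (0 : ℝ) < (2 ^ d : ℝ) ^ s := by positivity
  -- The factor `(2^d)^s` pays for replacing `|α|!` by `α!`; `I` is the total mass of the majorant.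
  refine ⟨⟨C₁ * (2 ^ d : ℝ) ^ s, by positivity⟩, A₁ * I, fun f => ?_⟩
  have hb := hred ‖f‖ _ (norm_nonneg f) (ha.integrand hG.1 hs0 f)
  have hcd : ContDiff ℝ ∞ (operatorFun M m₀ a f.1) := hb.contDiff_kernelIntegral hM
  have hw : ∀ q, weighted d s (C₁ * (2 ^ d : ℝ) ^ s) (operatorFun M m₀ a f.1) q ≤
      A₁ * I * ‖f‖ := by
    rintro ⟨α, x⟩
    unfold weighted
    rw [inv_mul_le_iff₀ (weight_pos s (by positivity) α), multiDeriv_eq_listDeriv _ _ hcd]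
    have h1 := hb.norm_listDeriv_kernelIntegral_le hM (multiList id α) x
    rw [map_multiList, Function.comp_id, length_multiList] at h1
    refine h1.trans ?_
    have hfac : ((order α).factorial : ℝ) ^ s ≤
        ((2 ^ d : ℝ) ^ s) ^ order α * (multiFactorial α : ℝ) ^ s := by
      have e : ((2 ^ d : ℝ) ^ s) ^ order α = ((2 ^ d : ℝ) ^ order α) ^ s := by
        rw [← Real.rpow_natCast, ← Real.rpow_natCast _ (order α),
          ← Real.rpow_mul (by positivity), ← Real.rpow_mul (by positivity), mul_comm s]
      rw [e, ← Real.mul_rpow (by positivity) (by positivity)]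
      exact Real.rpow_le_rpow (by positivity) (by exact_mod_cast factorial_order_le α) hs0
    calc G₁ (order α) * ‖f‖ * I
        ≤ A₁ * C₁ ^ order α *
          (((2 ^ d : ℝ) ^ s) ^ order α * (multiFactorial α : ℝ) ^ s) * ‖f‖ * I := by
          refine mul_le_mul_of_nonneg_right (mul_le_mul_of_nonneg_right
            ((hle _).trans (mul_le_mul_of_nonneg_left hfac (by positivity))) (norm_nonneg f)) hI0
      _ = _ := by rw [mul_pow]; ring
  refine ⟨⟨hcd, isAlmostPeriodic_operatorFun hs0 hM hG.1 ha hap f hcd.continuous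
    ⟨_, hb.norm_kernelIntegral_le hM⟩, ⟨A₁ * I * ‖f‖, ?_⟩⟩, hw⟩
  rintro _ ⟨q, rfl⟩
  exact hw q

/-! ### Linearity and uniqueness of the operator values -/

theorem regularizedIntegral_add {χ : Rd d → ℂ} (hχ : IsCutoff χ) (ha : ContDiff ℝ ∞ a)
    {f g : Rd d → ℂ} (hf : ContDiff ℝ ∞ f) (hg : ContDiff ℝ ∞ g) (x : Rd d) {ε : ℝ}
    (hε : 0 < ε) (hε1 : ε ≤ 1) :
    regularizedIntegral χ a (f + g) x ε =
      regularizedIntegral χ a f x ε + regularizedIntegral χ a g x ε := by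
  have hint : ∀ f : Rd d → ℂ, ContDiff ℝ ∞ f → Integrable fun p =>
      wave p * (cutoff χ (diffMap d) ε * integrand a f) (x, p) := by
    intro f hf
    obtain ⟨_, -, hcb⟩ := exists_cutoff_bound hχ
    have hc : ContDiff ℝ ∞ (cutoff χ (diffMap d) ε * integrand a f) :=
      ContDiff.mul (hcb 0 _ (norm_diffMap_le d) ε hε hε1).contDiff (contDiff_integrand ha hf)
    exact (contDiff_wave.continuous.mul
      (contDiff_slice hc x).continuous).integrable_of_hasCompactSupport
      (hasCompactSupport_cutoff_mul hχ norm_le_diffMap hε _ x).mul_left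
  simp only [regularizedIntegral_eq]
  rw [← integral_add (hint f hf) (hint g hg)]
  refine integral_congr_ae (Filter.Eventually.of_forall fun p => ?_)
  simp only [Pi.mul_apply, integrand_apply, Pi.add_apply]
  ring

theorem IsOperatorValue.add (ha : ContDiff ℝ ∞ a) {f g f' g' : Rd d → ℂ}
    (hf : ContDiff ℝ ∞ f) (hg : ContDiff ℝ ∞ g) (h : IsOperatorValue a f f')
    (h' : IsOperatorValue a g g') : IsOperatorValue a (f + g) (f' + g') := by
  intro χ hχ x
  refine ((h χ hχ x).add (h' χ hχ x)).congr' ?_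
  filter_upwards [Ioc_mem_nhdsGT (zero_lt_one (α := ℝ))] with ε hε
  exact (regularizedIntegral_add hχ ha hf hg x hε.1 hε.2).symm

theorem IsOperatorValue.smul (c : ℂ) {f f' : Rd d → ℂ} (h : IsOperatorValue a f f') :
    IsOperatorValue a (c • f) (c • f') := by
  intro χ hχ x
  refine ((h χ hχ x).const_mul c).congr fun ε => ?_
  unfold regularizedIntegral
  rw [← integral_const_mul]
  refine integral_congr_ae (Filter.Eventually.of_forall fun p => ?_)
  simp only [Pi.smul_apply, smul_eq_mul]
  ring

theorem IsOperatorValue.unique {f g g' : Rd d → ℂ} (h : IsOperatorValue a f g)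
    (h' : IsOperatorValue a f g') : g = g' := by
  obtain ⟨χ, hχ⟩ := exists_isCutoff d
  exact funext fun x => tendsto_nhds_unique (h χ hχ x) (h' χ hχ x)

end Operator

/-! ### Continuity for the inductive limit topology -/

/-- A linear map on `G_ap^s` which maps each step boundedly into some step is continuous. -/
theorem continuous_gap {d : ℕ} {s : ℝ} (T : Gap d s →ₗ[ℂ] Gap d s)
    (h : ∀ C : {C : ℝ // 0 < C}, ∃ (C' : {C : ℝ // 0 < C}) (A : ℝ), ∀ f : Step d s C,
      MemStep d s C'.1 (T (incl d s C f)).1 ∧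
        ∀ q, weighted d s C'.1 (T (incl d s C f)).1 q ≤ A * ‖f‖) : Continuous T := by
  rw [continuous_iff_le_induced]
  obtain ⟨h1, h2, h3, h4⟩ := inductiveLimit_mem d s
  -- The topology induced by `T` is itself admissible, hence coarser than the inductive limit
  -- topology, which is the finest admissible one.
  refine sInf_le ⟨topologicalAddGroup_induced T, continuousSMul_induced T,
    LocallyConvexSpace.induced (T.restrictScalars ℝ), fun C => ?_⟩
  rw [continuous_induced_rng]
  obtain ⟨C', A, hA⟩ := h C
  have hadd : ∀ f g : Step d s C,
      (T (incl d s C (f + g))).1 = (T (incl d s C f)).1 + (T (incl d s C g)).1 := fun f g =>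
    congrArg (fun h : Gap d s => h.1)
      (show T (incl d s C (f + g)) = T (incl d s C f) + T (incl d s C g) by
        rw [map_add, map_add])
  have hsmul : ∀ (c : ℂ) (f : Step d s C),
      (T (incl d s C (c • f))).1 = c • (T (incl d s C f)).1 := fun c f =>
    congrArg (fun h : Gap d s => h.1)
      (show T (incl d s C (c • f)) = c • T (incl d s C f) by rw [map_smul, map_smul])
  -- The restriction of `T` as a bounded map between normed steps; composed with the inclusion of
  -- the target step it is `T` on the step `C`.
  let S : Step d s C →ₗ[ℂ] Step d s C' :=
    { toFun := fun f => ⟨(T (incl d s C f)).1, (hA f).1⟩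
      map_add' := fun f g => Subtype.ext (hadd f g)
      map_smul' := fun c f => Subtype.ext (hsmul c f) }
  have hS : Continuous S := (S.mkContinuous A fun f => ciSup_le fun q => (hA f).2 q).continuous
  exact (h4 C').comp hS

end GevreyAP

theorem proposition4p4 (d : ℕ) (ρ m s : ℝ) (hρ : 0 < ρ) (hρ1 : ρ ≤ 1) (hs : 1 ≤ s)
    (hsρ : 1 ≤ s * ρ) (a : GevreyAP.Rd d × GevreyAP.Rd d × GevreyAP.Rd d → ℂ)
    (ha : GevreyAP.IsAmplitude d ρ 0 m s a) :
    ∃ T : GevreyAP.Gap d s →L[ℂ] GevreyAP.Gap d s,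
      ∀ f : GevreyAP.Gap d s, GevreyAP.IsOperatorValue a f (T f) := by
  open GevreyAP in
  obtain ⟨M, m₀, G, -, hM, hG, hb⟩ := ha.exists_derivBound hρ hρ1 hs
  have hs0 : 0 ≤ s := by linarith
  have hval : ∀ f : Gap d s, IsOperatorValue a f (operatorFun M m₀ a f) := by
    rintro ⟨f, C, hf⟩
    exact isOperatorValue_operatorFun (C := C) hs0 hM hG.1 hb ⟨f, hf⟩
  have hmem : ∀ f : Gap d s, operatorFun M m₀ a f ∈ gapSubmodule d s := by
    rintro ⟨f, C, hf⟩
    obtain ⟨C', A, h⟩ := exists_step_bound hs hM hG hb ha C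
    exact ⟨C', (h ⟨f, hf⟩).1⟩
  have hsmooth : ∀ f : Gap d s, ContDiff ℝ ∞ f.1 := by
    rintro ⟨f, C, hf⟩
    exact MemStep.contDiff hf
  -- Linearity is read off from the regularized limits, whose values are unique, rather than from
  -- the formula for `operatorFun`.
  let T : Gap d s →ₗ[ℂ] Gap d s :=
    { toFun := fun f => ⟨operatorFun M m₀ a f, hmem f⟩
      map_add' := fun f g => Subtype.ext ((hval (f + g)).unique
        ((hval f).add ha.contDiff (hsmooth f) (hsmooth g) (hval g)))
      map_smul' := fun c f => Subtype.ext ((hval (c • f)).unique ((hval f).smul c)) }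
  exact ⟨⟨T, continuous_gap T fun C => exists_step_bound hs hM hG hb ha C⟩, hval⟩
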